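/- Let $d\ge 1$, $t_1>0$, and let $l^2$ be the Hilbert space of square summable complex families $U=(U_\nu)_{\nu\in\mathbb N_0^d}$. **Control systems.** Let $Z$ be a complex Hilbert space, $A$ the infinitesimal generator of a strongly continuous semigroup $(T(t))_{t\ge0}$ on $Z$, and $B:l^2\to Z$ bounded and linear. The mild solution of $z'=Az+Bu$, $z(0)=z_0$, with control $u\in L^2(0,t_1;l^2)$ is $z(t)=T(t)z_0+\int_0^tT(t-s)Bu(s)\,ds$. The system is *approximately controllable on $[0,t_1]$* if for all $z_0,z_1\in Z$ and $\varepsilon>0$ there is $u\in L^2(0,t_1;l^2)$ with $\|z(t_1)-z_1\|\le\varepsilon$, and *exactly controllable on $[0,t_1]$* if for all $z_0,z_1\in Z$ there is $u\in L^2(0,t_1;l^2)$ with $z(t_1)=z_1$. **(i) Laguerre.** Let $\alpha\in(-1,\infty)^d$, $\mu_\alpha(dx)=\prod_{i=1}^d\frac{x_i^{\alpha_i}e^{-x_i}}{\Gamma(\alpha_i+1)}\,dx$ on $\mathbb R_+^d$, and let $$l^\alpha_\nu(x)=\prod_{i=1}^d\sqrt{\frac{\Gamma(\alpha_i+1)}{\nu_i!\,\Gamma(\nu_i+\alpha_i+1)}}\,(-1)^{\nu_i}x_i^{-\alpha_i}e^{x_i}\frac{d^{\nu_i}}{dx_i^{\nu_i}}\bigl(x_i^{\nu_i+\alpha_i}e^{-x_i}\bigr),\qquad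 \nu\in\mathbb N_0^d,$$ be the normalized Laguerre polynomials. Let $\mathcal L^\alpha$ be the closure in $L^2(\mathbb R_+^d,\mu_\alpha)$ (complex-valued functions) of the operator $\sum_{i=1}^d\bigl[x_i\partial_i^2+(\alpha_i+1-x_i)\partial_i\bigr]$ on polynomials. Let $b\in L^2(\mathbb R_+^d,\mu_\alpha)$ and $BU=\sum_\nu U_\nu\langle b,l^\alpha_\nu\rangle\, l^\alpha_\nu$, where $\langle b,l^\alpha_\nu\rangle=\int b\,l^\alpha_\nu\,d\mu_\alpha$. If $\langle b,l^\alpha_\nu\rangle\neq0$ for every $\nu\in\mathbb N_0^d$, then $\mathcal L^\alpha$ generates a strongly continuous semigroup and the system $z'=\mathcal L^\alpha z+Bu$ is approximately controllable on $[0,t_1]$ but not exactly controllable on $[0,t_1]$. **(ii) Jacobi.** Let $\alpha,\beta\in(-1,\infty)^d$, $\mu_{\alpha,\beta}(dx)=\prod_{i=1}^d(1-x_i)^{\alpha_i}(1+x_i)^{\beta_i}\,dx$ on $[-1,1]^d$, and let $$p^{\alpha,\beta}_\nu(x)=\prod_{i=1}^d\bigl(h^{(\alpha_i,\beta_i)}_{\nu_i}\bigr)^{-1/2}(1-x_i)^{-\alpha_i}(1+x_i)^{-\beta_i}\frac{(-1)^{\nu_i}}{2^{\nu_i}\nu_i!}\frac{d^{\nu_i}}{dx_i^{\nu_i}}\bigl((1-x_i)^{\alpha_i+\nu_i}(1+x_i)^{\beta_i+\nu_i}\bigr)$$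 be the normalized Jacobi polynomials, where $h^{(a,b)}_n=\frac{2^{a+b+1}}{2n+a+b+1}\frac{\Gamma(n+a+1)\Gamma(n+b+1)}{\Gamma(n+1)\Gamma(n+a+b+1)}$ for $n\ge1$ and $h^{(a,b)}_0=2^{a+b+1}\frac{\Gamma(a+1)\Gamma(b+1)}{\Gamma(a+b+2)}$. Let $\mathcal L^{\alpha,\beta}$ be the closure in $L^2([-1,1]^d,\mu_{\alpha,\beta})$ of the operator $\sum_{i=1}^d\bigl[(1-x_i^2)\partial_i^2+(\beta_i-\alpha_i-(\alpha_i+\beta_i+2)x_i)\partial_i\bigr]$ on polynomials. Let $b\in L^2([-1,1]^d,\mu_{\alpha,\beta})$ and $\tilde BU=\sum_\nu U_\nu\langle b,p^{\alpha,\beta}_\nu\rangle\,p^{\alpha,\beta}_\nu$, where $\langle b,p^{\alpha,\beta}_\nu\rangle=\int b\,p^{\alpha,\beta}_\nu\,d\mu_{\alpha,\beta}$. If $\langle b,p^{\alpha,\beta}_\nu\rangle\neq0$ for every $\nu\in\mathbb N_0^d$, then $\mathcal L^{\alpha,\beta}$ generates a strongly continuous semigroup and the system $w'=\mathcal L^{\alpha,\beta}w+\tilde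 B\tilde u$ is approximately controllable on $[0,t_1]$ but not exactly controllable on $[0,t_1]$. -/

import Mathlib

open MeasureTheory Filter Topology

noncomputable section

namespace OrthControl

/-! ## Linear control systems `z' = A z + B u` in a complex Hilbert space -/

section System

variable {H : Type*} [NormedAddCommGroup H] [InnerProductSpace ℂ H] [CompleteSpace H]
variable {U : Type*} [NormedAddCommGroup U] [InnerProductSpace ℂ U]

/-- `(T t)_{t ≥ 0}` is a strongly continuous one-parameter semigroup of bounded operators.
Values of `T` at negative times are irrelevant. -/
structure IsC0Semigroup (T : ℝ → H →L[ℂ] H) : Prop where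
  zero : T 0 = ContinuousLinearMap.id ℂ H
  add : ∀ s t : ℝ, 0 ≤ s → 0 ≤ t → T (s + t) = (T s).comp (T t)
  continuousOn : ∀ z : H, ContinuousOn (fun t : ℝ => T t z) (Set.Ici 0)

/-- `A`, an unbounded operator given by its graph, is the infinitesimal generator of the
strongly continuous semigroup `T`: the pair `(z, w)` lies in the graph of `A` exactly when
`(T t z - z) / t → w` as `t → 0+`. -/
structure Generates (A : Set (H × H)) (T : ℝ → H →L[ℂ] H) : Prop where
  isC0Semigroup : IsC0Semigroup T
  mem_iff : ∀ z w : H, (z, w) ∈ A ↔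
    Tendsto (fun t : ℝ => ((t : ℂ)⁻¹) • (T t z - z)) (𝓝[>] 0) (𝓝 w)

/-- The mild solution at time `t` of `z' = A z + B u`, `z 0 = z₀`, where `A` generates `T`:
`z t = T t z₀ + ∫₀ᵗ T (t - s) (B (u s)) ds`. -/
def mildSolution (T : ℝ → H →L[ℂ] H) (B : U → H) (u : ℝ → U) (z₀ : H) (t : ℝ) : H :=
  T t z₀ + ∫ s in (0 : ℝ)..t, T (t - s) (B (u s))

/-- `u ∈ L²(0, t₁; U)`. -/
def IsControl (t₁ : ℝ) (u : ℝ → U) : Prop :=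
  MemLp u 2 (volume.restrict (Set.Ioc 0 t₁))

/-- `z' = A z + B u` is approximately controllable on `[0, t₁]`: `A` generates a strongly
continuous semigroup (which is unique), and from every state one can steer arbitrarily near to
every other state in time `t₁`. -/
def ApproximatelyControllable (A : Set (H × H)) (B : U → H) (t₁ : ℝ) : Prop :=
  ∃ T : ℝ → H →L[ℂ] H, Generates A T ∧
    ∀ z₀ z₁ : H, ∀ ε : ℝ, 0 < ε →
      ∃ u : ℝ → U, IsControl t₁ u ∧ ‖mildSolution T B u z₀ t₁ - z₁‖ ≤ ε

/-- `z' = A z + B u` is exactly controllable on `[0, t₁]`: `A` generates a strongly continuous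
semigroup (which is unique), and from every state one can steer to every other state in
time `t₁`. -/
def ExactlyControllable (A : Set (H × H)) (B : U → H) (t₁ : ℝ) : Prop :=
  ∃ T : ℝ → H →L[ℂ] H, Generates A T ∧
    ∀ z₀ z₁ : H, ∃ u : ℝ → U, IsControl t₁ u ∧ mildSolution T B u z₀ t₁ = z₁

end System

/-! ## Polynomial differential operators and diagonal control operators on `L²(μ)` -/

section Diagonal

variable {d : ℕ}

/-- The Hilbert space `l²` of square summable complex families indexed by multi-indices. -/
abbrev MultiL2 (d : ℕ) : Type := lp (fun _ : Fin d → ℕ => ℂ) 2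

/-- The function on `ℝᵈ` defined by a polynomial with complex coefficients. -/
def polyFun (p : MvPolynomial (Fin d) ℂ) (x : Fin d → ℝ) : ℂ :=
  MvPolynomial.eval (fun i => (x i : ℂ)) p

/-- The graph of the closure in `L²(μ)` of an operator `D` defined on the polynomials. -/
def closedOperator (μ : Measure (Fin d → ℝ))
    (D : MvPolynomial (Fin d) ℂ → MvPolynomial (Fin d) ℂ) :
    Set (Lp ℂ 2 μ × Lp ℂ 2 μ) :=
  closure {q | ∃ p : MvPolynomial (Fin d) ℂ, q.1 =ᵐ[μ] polyFun p ∧ q.2 =ᵐ[μ] polyFun (D p)}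

open Classical in
/-- The class in `L²(μ)` of a real function (zero if it is not square integrable, which never
happens for the functions used below). -/
def toL2 (μ : Measure (Fin d → ℝ)) (f : (Fin d → ℝ) → ℝ) : Lp ℂ 2 μ :=
  if h : MemLp (fun x => (f x : ℂ)) 2 μ then h.toLp (fun x => (f x : ℂ)) else 0

/-- The Fourier coefficient `∫ b e_ν dμ`. -/
def fourierCoef (μ : Measure (Fin d → ℝ)) (e : (Fin d → ℕ) → (Fin d → ℝ) → ℝ)
    (b : Lp ℂ 2 μ) (ν : Fin d → ℕ) : ℂ :=
  ∫ x, b x * (e ν x : ℂ) ∂μ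

/-- The control operator `B U = ∑_ν U_ν ⟨b, e_ν⟩ e_ν` from `l²` to `L²(μ)`. -/
def controlOperator (μ : Measure (Fin d → ℝ)) (e : (Fin d → ℕ) → (Fin d → ℝ) → ℝ)
    (b : Lp ℂ 2 μ) (V : MultiL2 d) : Lp ℂ 2 μ :=
  ∑' ν : Fin d → ℕ, (V ν * fourierCoef μ e b ν) • toL2 μ (e ν)

end Diagonal

/-! ## Laguerre -/

section Laguerre

variable {d : ℕ}

/-- The Gamma measure `∏ᵢ xᵢ^αᵢ e^(-xᵢ) / Γ(αᵢ + 1) dx` on `ℝ₊ᵈ`. -/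
def laguerreMeasure (α : Fin d → ℝ) : Measure (Fin d → ℝ) :=
  Measure.pi fun i => (volume.restrict (Set.Ioi (0 : ℝ))).withDensity fun x =>
    ENNReal.ofReal (x ^ α i * Real.exp (-x) / Real.Gamma (α i + 1))

/-- The normalized Laguerre polynomial of degree `n` in one variable `x > 0`, by the formula of
Rodrigues. -/
def laguerre1 (a : ℝ) (n : ℕ) (x : ℝ) : ℝ :=
  √(Real.Gamma (a + 1) / (n.factorial * Real.Gamma (n + a + 1))) *
    ((-1) ^ n * x ^ (-a) * Real.exp x *
      iteratedDeriv n (fun y : ℝ => y ^ (n + a) * Real.exp (-y)) x)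

/-- The normalized Laguerre polynomials `l^α_ν` in `d` variables. -/
def laguerre (α : Fin d → ℝ) (ν : Fin d → ℕ) (x : Fin d → ℝ) : ℝ :=
  ∏ i, laguerre1 (α i) (ν i) (x i)

/-- `∑ᵢ [xᵢ ∂ᵢ² + (αᵢ + 1 - xᵢ) ∂ᵢ]` on polynomials. -/
def laguerreDiff (α : Fin d → ℝ) (p : MvPolynomial (Fin d) ℂ) : MvPolynomial (Fin d) ℂ :=
  ∑ i, (MvPolynomial.X i * MvPolynomial.pderiv i (MvPolynomial.pderiv i p) +
    (MvPolynomial.C ((α i + 1 : ℝ) : ℂ) - MvPolynomial.X i) * MvPolynomial.pderiv i p)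

/-- The Laguerre operator on `L²(ℝ₊ᵈ, μ_α)`. -/
def laguerreOperator (α : Fin d → ℝ) :
    Set (Lp ℂ 2 (laguerreMeasure α) × Lp ℂ 2 (laguerreMeasure α)) :=
  closedOperator (laguerreMeasure α) (laguerreDiff α)

end Laguerre

/-! ## Jacobi -/

section Jacobi

variable {d : ℕ}

/-- The Jacobi measure `∏ᵢ (1 - xᵢ)^αᵢ (1 + xᵢ)^βᵢ dx` on `[-1, 1]ᵈ`. -/
def jacobiMeasure (α β : Fin d → ℝ) : Measure (Fin d → ℝ) :=
  Measure.pi fun i => (volume.restrict (Set.Icc (-1 : ℝ) 1)).withDensity fun x =>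
    ENNReal.ofReal ((1 - x) ^ α i * (1 + x) ^ β i)

/-- The squared norm `h_n` of the Jacobi polynomial of degree `n`. The case `n = 0` is the
general expression simplified by `z Γ(z) = Γ(z + 1)` for `z = a + b + 1`, so that it also makes
sense for `a + b + 1 = 0`. -/
def jacobiNormSq (a b : ℝ) (n : ℕ) : ℝ :=
  if n = 0 then
    2 ^ (a + b + 1) * (Real.Gamma (a + 1) * Real.Gamma (b + 1)) / Real.Gamma (a + b + 2)
  else
    2 ^ (a + b + 1) / (2 * n + a + b + 1) *
      (Real.Gamma (n + a + 1) * Real.Gamma (n + b + 1) /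
        (Real.Gamma (n + 1) * Real.Gamma (n + a + b + 1)))

/-- The normalized Jacobi polynomial of degree `n` in one variable `-1 < x < 1`, by the formula
of Rodrigues. -/
def jacobi1 (a b : ℝ) (n : ℕ) (x : ℝ) : ℝ :=
  (√(jacobiNormSq a b n))⁻¹ *
    ((1 - x) ^ (-a) * (1 + x) ^ (-b) * ((-1) ^ n / (2 ^ n * n.factorial)) *
      iteratedDeriv n (fun y : ℝ => (1 - y) ^ (a + n) * (1 + y) ^ (b + n)) x)

/-- The normalized Jacobi polynomials `p^{α,β}_ν` in `d` variables. -/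
def jacobi (α β : Fin d → ℝ) (ν : Fin d → ℕ) (x : Fin d → ℝ) : ℝ :=
  ∏ i, jacobi1 (α i) (β i) (ν i) (x i)

/-- `∑ᵢ [(1 - xᵢ²) ∂ᵢ² + (βᵢ - αᵢ - (αᵢ + βᵢ + 2) xᵢ) ∂ᵢ]` on polynomials. -/
def jacobiDiff (α β : Fin d → ℝ) (p : MvPolynomial (Fin d) ℂ) : MvPolynomial (Fin d) ℂ :=
  ∑ i, ((1 - MvPolynomial.X i ^ 2) * MvPolynomial.pderiv i (MvPolynomial.pderiv i p) +
    (MvPolynomial.C ((β i - α i : ℝ) : ℂ) -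
      MvPolynomial.C ((α i + β i + 2 : ℝ) : ℂ) * MvPolynomial.X i) * MvPolynomial.pderiv i p)

/-- The Jacobi operator on `L²([-1, 1]ᵈ, μ_{α,β})`. -/
def jacobiOperator (α β : Fin d → ℝ) :
    Set (Lp ℂ 2 (jacobiMeasure α β) × Lp ℂ 2 (jacobiMeasure α β)) :=
  closedOperator (jacobiMeasure α β) (jacobiDiff α β)

end Jacobi

end OrthControl

end

noncomputable section

namespace OrthControl

/-! ### Systems diagonal in a Hilbert basis -/

section DiagonalSystems

variable {ι H : Type*} [NormedAddCommGroup H] [InnerProductSpace ℂ H]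

/-! The normalized polynomials form a Hilbert basis in which both the operator and the control
operator are diagonal, with eigenvalues `-lam i ≤ 0` and control coefficients `c i = ⟨b, e i⟩`,
nonzero and square summable. For such a system both controllability claims are short.

Approximate controllability: truncate the target `z₁ - T t₁ z₀` to finitely many coordinates. A
control made of finitely many exponentials makes the integrand of the mild solution constant in time
and so reaches the truncation exactly; this needs only `c i ≠ 0` (`approximatelyControllable_diag`).

Failure of exact controllability: a state `z` reached from `0` has `|⟨e i, z⟩| ≤ |c i| ∫ ‖u‖`, so if
every state were reachable the functionals `(c i)⁻¹ ⟨e i, ·⟩` would be pointwise bounded.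
Banach–Steinhaus then bounds `|c i|⁻¹` uniformly, although `c i → 0` along an infinite index set
(`not_exactlyControllable_diag`).

The remaining work is the reduction to the diagonal case. In one variable, Laguerre and Jacobi are
treated together through a weight with Pearson equation `(σ w)' = τ w`. Its integral version, `E (σ
p' + τ p) = 0`, yields orthogonality, norms and the eigenvalue equation for the Rodrigues
polynomials by algebra alone (`isClassicalSystem_rodrigues`). For each family there remain Gamma or
Beta integrals and the comparison with the stated normalization.

In several variables, products of these polynomials are orthonormal eigenvectors. They are complete
because the measure has an exponential moment, which makes a function orthogonal to all polynomials
have vanishing Fourier transform (`ae_eq_zero_of_orthogonal_polyFun`). Since they are polynomials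
themselves, the closure of the operator from polynomials is the diagonal operator on its maximal
domain (`closedOperator_productDiff`), which generates the diagonal semigroup
(`generates_diagSemigroup`). -/

theorem eq_of_forall_inner_eq (e : HilbertBasis ι ℂ H) {x y : H}
    (h : ∀ i, inner ℂ (e i) x = inner ℂ (e i) y) : x = y :=
  e.repr.injective (lp.ext (funext fun i => by
    rw [e.repr_apply_apply, e.repr_apply_apply, h]))

theorem hasSum_norm_sq_inner (e : HilbertBasis ι ℂ H) (x : H) :
    HasSum (fun i => ‖inner ℂ (e i) x‖ ^ 2) (‖x‖ ^ 2) := by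
  have h := lp.hasSum_norm (p := 2) (by norm_num) (e.repr x)
  simpa [e.repr_apply_apply] using h

/-- Dominated convergence for the coordinates with respect to a Hilbert basis. -/
theorem tendsto_of_tendsto_inner (e : HilbertBasis ι ℂ H) {β : Type*} {l : Filter β}
    {x : β → H} {y : H} {g : ι → ℝ} (hg : Summable fun i => g i ^ 2)
    (hle : ∀ᶠ a in l, ∀ i, ‖inner ℂ (e i) (x a - y)‖ ≤ g i)
    (hl : ∀ i, Tendsto (fun a => inner ℂ (e i) (x a)) l (𝓝 (inner ℂ (e i) y))) :
    Tendsto x l (𝓝 y) := by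
  have key : Tendsto (fun a => ∑' i, ‖inner ℂ (e i) (x a - y)‖ ^ 2) l (𝓝 (∑' _ : ι, (0 : ℝ))) := by
    refine tendsto_tsum_of_dominated_convergence hg (fun i => ?_) ?_
    · have := ((hl i).sub_const (inner ℂ (e i) y)).norm.pow 2
      simpa [inner_sub_right] using this
    · filter_upwards [hle] with a ha i
      rw [Real.norm_of_nonneg (by positivity)]
      exact pow_le_pow_left₀ (norm_nonneg _) (ha i) 2
  simp only [(hasSum_norm_sq_inner e _).tsum_eq, tsum_zero] at key
  rw [tendsto_iff_norm_sub_tendsto_zero]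
  have := key.sqrt
  simpa using this

/-- The operator which multiplies the coordinates with respect to a Hilbert basis by numbers of
modulus at most one. -/
def diagOp (e : HilbertBasis ι ℂ H) (m : ι → ℂ) (hm : ∀ i, ‖m i‖ ≤ 1) : H →L[ℂ] H :=
  LinearMap.mkContinuous
    { toFun := fun x => e.repr.symm ⟨fun i => m i * e.repr x i,
        (lp.memℓp (e.repr x)).mono' fun i => by
          rw [norm_mul]
          exact mul_le_of_le_one_left (norm_nonneg _) (hm i)⟩
      map_add' := fun x y => by
        rw [← map_add]
        congr 1
        ext i
        exact (congrArg (fun v => m i * v i) (congrArg Subtype.val (map_add e.repr x y))).trans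
          (mul_add (m i) (e.repr x i) (e.repr y i))
      map_smul' := fun a x => by
        rw [← map_smul]
        congr 1
        ext i
        simp [mul_left_comm] } 1 fun x => by
    simp only [LinearMap.coe_mk, AddHom.coe_mk, LinearIsometryEquiv.norm_map, one_mul]
    rw [← e.repr.norm_map x]
    refine lp.norm_mono (by norm_num) fun i => ?_
    simp only [norm_mul]
    exact mul_le_of_le_one_left (norm_nonneg _) (hm i)

theorem inner_diagOp (e : HilbertBasis ι ℂ H) (m : ι → ℂ) (hm : ∀ i, ‖m i‖ ≤ 1) (x : H) (i : ι) :
    inner ℂ (e i) (diagOp e m hm x) = m i * inner ℂ (e i) x := by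
  rw [← e.repr_apply_apply, ← e.repr_apply_apply]
  simp [diagOp]

theorem norm_exp_neg_le_one {a : ℝ} (ha : 0 ≤ a) : ‖Complex.exp (-(a : ℂ))‖ ≤ 1 := by
  rw [Complex.norm_exp]
  simpa using ha

/-- The semigroup with `T t (e i) = exp (-lam i * t) • e i`, constant for negative times. -/
def diagSemigroup (e : HilbertBasis ι ℂ H) {lam : ι → ℝ} (hlam : ∀ i, 0 ≤ lam i) (t : ℝ) :
    H →L[ℂ] H :=
  diagOp e (fun i => Complex.exp (-((lam i * max t 0 : ℝ) : ℂ))) fun i =>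
    norm_exp_neg_le_one (mul_nonneg (hlam i) (le_max_right _ _))

theorem inner_diagSemigroup (e : HilbertBasis ι ℂ H) {lam : ι → ℝ} (hlam : ∀ i, 0 ≤ lam i)
    {t : ℝ} (ht : 0 ≤ t) (x : H) (i : ι) :
    inner ℂ (e i) (diagSemigroup e hlam t x) =
      Complex.exp (-((lam i * t : ℝ) : ℂ)) * inner ℂ (e i) x := by
  rw [diagSemigroup, inner_diagOp, max_eq_left ht]

/-- The graph of the operator with `A (e i) = -lam i • e i`, with its maximal domain. -/
def diagGraph (e : HilbertBasis ι ℂ H) (lam : ι → ℝ) : Set (H × H) :=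
  {q | ∀ i, inner ℂ (e i) q.2 = -(lam i : ℂ) * inner ℂ (e i) q.1}

theorem isC0Semigroup_diagSemigroup (e : HilbertBasis ι ℂ H) {lam : ι → ℝ}
    (hlam : ∀ i, 0 ≤ lam i) : IsC0Semigroup (diagSemigroup e hlam) where
  zero := by
    ext x
    refine eq_of_forall_inner_eq e fun i => ?_
    simp [inner_diagSemigroup e hlam le_rfl]
  add s t hs ht := by
    ext x
    refine eq_of_forall_inner_eq e fun i => ?_
    rw [inner_diagSemigroup e hlam (add_nonneg hs ht), ContinuousLinearMap.comp_apply,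
      inner_diagSemigroup e hlam hs, inner_diagSemigroup e hlam ht, ← mul_assoc, ← Complex.exp_add]
    congr 2
    push_cast
    ring
  continuousOn z := by
    -- Because the semigroup is frozen at negative times, continuity holds on all of `ℝ` and no
    -- one-sided limit at `0` is needed.
    refine Continuous.continuousOn (continuous_iff_continuousAt.2 fun t => ?_)
    refine tendsto_of_tendsto_inner e (g := fun i => 2 * ‖inner ℂ (e i) z‖) ?_
      (Eventually.of_forall fun s i => ?_) fun i => ?_
    · simpa only [mul_pow] using (hasSum_norm_sq_inner e z).summable.mul_left (2 ^ 2)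
    · rw [inner_sub_right]
      simp only [diagSemigroup, inner_diagOp]
      refine (norm_sub_le _ _).trans ?_
      rw [two_mul, norm_mul, norm_mul]
      gcongr <;> exact mul_le_of_le_one_left (norm_nonneg _)
        (norm_exp_neg_le_one (mul_nonneg (hlam i) (le_max_right _ _)))
    · simp only [diagSemigroup, inner_diagOp]
      have : Continuous fun s : ℝ =>
          Complex.exp (-((lam i * max s 0 : ℝ) : ℂ)) * inner ℂ (e i) z := by fun_prop
      exact this.tendsto t

theorem tendsto_exp_quotient (a : ℝ) :
    Tendsto (fun t : ℝ => ((t : ℂ)⁻¹) * (Complex.exp (-((a * t : ℝ) : ℂ)) - 1)) (𝓝[>] 0)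
      (𝓝 (-(a : ℂ))) := by
  have h : HasDerivAt (fun t : ℝ => Complex.exp (-((a * t : ℝ) : ℂ))) (-(a : ℂ)) 0 := by
    have h1 : HasDerivAt (fun t : ℝ => -((a * t : ℝ) : ℂ)) (-(a : ℂ)) 0 := by
      have h2 : HasDerivAt (fun t : ℝ => a * t) a 0 := by
        simpa using (hasDerivAt_id (0 : ℝ)).const_mul a
      exact h2.ofReal_comp.neg
    simpa using h1.cexp
  have := h.tendsto_slope_zero_right
  refine this.congr fun t => ?_
  simp

/-- This is `1 - exp (-x) ≤ x`. The bound is independent of `t`, so it dominates the difference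
quotients in `generates_diagSemigroup`. -/
theorem norm_exp_quotient_le {a t : ℝ} (ha : 0 ≤ a) (ht : 0 < t) :
    ‖((t : ℂ)⁻¹) * (Complex.exp (-((a * t : ℝ) : ℂ)) - 1)‖ ≤ a := by
  have h1 : Complex.exp (-((a * t : ℝ) : ℂ)) - 1 = ((Real.exp (-(a * t)) - 1 : ℝ) : ℂ) := by
    push_cast
    rfl
  have hat : 0 ≤ a * t := mul_nonneg ha ht.le
  rw [h1, norm_mul, norm_inv, Complex.norm_real, Complex.norm_real, Real.norm_of_nonneg ht.le,
    Real.norm_eq_abs, abs_sub_comm, abs_of_nonneg (by simpa using hat), inv_mul_le_iff₀ ht]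
  nlinarith [Real.add_one_le_exp (-(a * t))]

theorem generates_diagSemigroup (e : HilbertBasis ι ℂ H) {lam : ι → ℝ}
    (hlam : ∀ i, 0 ≤ lam i) : Generates (diagGraph e lam) (diagSemigroup e hlam) where
  isC0Semigroup := isC0Semigroup_diagSemigroup e hlam
  mem_iff z w := by
    have hcoef : ∀ t : ℝ, 0 < t → ∀ i,
        inner ℂ (e i) (((t : ℂ)⁻¹) • (diagSemigroup e hlam t z - z)) =
          ((t : ℂ)⁻¹) * (Complex.exp (-((lam i * t : ℝ) : ℂ)) - 1) * inner ℂ (e i) z := by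
      intro t ht i
      rw [inner_smul_right, inner_sub_right, inner_diagSemigroup e hlam ht.le]
      ring
    have hlim : ∀ i, Tendsto (fun t : ℝ =>
        inner ℂ (e i) (((t : ℂ)⁻¹) • (diagSemigroup e hlam t z - z))) (𝓝[>] 0)
          (𝓝 (-(lam i : ℂ) * inner ℂ (e i) z)) := by
      intro i
      refine ((tendsto_exp_quotient (lam i)).mul_const _).congr' ?_
      filter_upwards [self_mem_nhdsWithin] with t ht
      rw [hcoef t ht]
    constructor
    · intro h
      change ∀ i, inner ℂ (e i) w = -(lam i : ℂ) * inner ℂ (e i) z at h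
      refine tendsto_of_tendsto_inner e (g := fun i => 2 * ‖inner ℂ (e i) w‖) ?_ ?_ fun i => ?_
      · simpa only [mul_pow] using (hasSum_norm_sq_inner e w).summable.mul_left (2 ^ 2)
      · filter_upwards [self_mem_nhdsWithin] with t ht i
        rw [inner_sub_right]
        refine (norm_sub_le _ _).trans ?_
        rw [two_mul, hcoef t ht]
        gcongr
        -- The coordinate of the quotient is at most `lam i * ‖⟨e i, z⟩‖ = ‖⟨e i, w⟩‖`: membership
        -- of `(z, w)` in the graph is exactly what supplies a square summable dominating family.
        rw [h i, norm_mul, norm_mul (-(lam i : ℂ)), norm_neg, Complex.norm_real,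
          Real.norm_of_nonneg (hlam i)]
        gcongr
        exact norm_exp_quotient_le (hlam i) ht
      · rw [h i]
        exact hlim i
    · intro h i
      exact tendsto_nhds_unique (tendsto_const_nhds.inner h) (hlim i)

/-- The function `exp (a s) • T s x` is continuous with right derivative zero, hence constant. Exact
controllability quantifies over an arbitrary semigroup with the given generator, so that semigroup
has to be identified on eigenvectors. -/
theorem Generates.apply_eigenvector {A : Set (H × H)} {T : ℝ → H →L[ℂ] H} (hT : Generates A T)
    {x : H} {a : ℝ} (hx : (x, -(a : ℂ) • x) ∈ A) {t : ℝ} (ht : 0 ≤ t) :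
    T t x = Complex.exp (-((a * t : ℝ) : ℂ)) • x := by
  have hS := hT.isC0Semigroup
  let g : ℝ → ℂ := fun s => Complex.exp ((a * s : ℝ) : ℂ)
  have hg : ∀ s, HasDerivAt g (g s * a) s := by
    intro s
    have h2 : HasDerivAt (fun t : ℝ => a * t) a s := by
      simpa using (hasDerivAt_id s).const_mul a
    exact h2.ofReal_comp.cexp
  have hTd : ∀ s : ℝ, 0 ≤ s →
      HasDerivWithinAt (fun s => T s x) (-(a : ℂ) • T s x) (Set.Ici s) s := by
    intro s hs
    rw [← hasDerivWithinAt_Ioi_iff_Ici, hasDerivWithinAt_iff_tendsto_slope' (by simp)]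
    have h1 := ((T s).continuous.tendsto _).comp ((hT.mem_iff _ _).1 hx)
    have h2 : Tendsto (fun r : ℝ => r - s) (𝓝[>] s) (𝓝[>] 0) := by
      refine tendsto_nhdsWithin_iff.2 ⟨?_, ?_⟩
      · have : Tendsto (fun r : ℝ => r - s) (𝓝 s) (𝓝 (s - s)) :=
          (continuous_id.sub continuous_const).tendsto s
        rw [sub_self] at this
        exact this.mono_left nhdsWithin_le_nhds
      · filter_upwards [self_mem_nhdsWithin] with r hr
        exact sub_pos.2 (Set.mem_Ioi.1 hr)
    have h3 := h1.comp h2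
    rw [map_smul] at h3
    refine h3.congr' ?_
    filter_upwards [self_mem_nhdsWithin] with r hr
    have hr' : s < r := hr
    have h4 : T r x = T s (T (r - s) x) := by
      have := hS.add s (r - s) hs (by linarith)
      rw [add_sub_cancel] at this
      rw [this]
      rfl
    simp only [Function.comp_apply, slope, vsub_eq_sub, map_smul, map_sub, h4]
    rw [← Complex.ofReal_inv]
    exact Complex.coe_smul _ _
  have hconst := constant_of_has_deriv_right_zero (f := fun s => g s • T s x) (a := 0) (b := t)
    ?_ ?_ t ⟨ht, le_rfl⟩
  · simp only [hS.zero, g, mul_zero, Complex.ofReal_zero, Complex.exp_zero, one_smul,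
      ContinuousLinearMap.id_apply] at hconst
    have h := congrArg (fun y => Complex.exp (-((a * t : ℝ) : ℂ)) • y) hconst
    simpa only [smul_smul, ← Complex.exp_add, neg_add_cancel, Complex.exp_zero, one_smul] using h
  · have hgc : Continuous g := by fun_prop
    exact hgc.continuousOn.smul ((hS.continuousOn x).mono fun s hs => hs.1)
  · intro s hs
    have := (hg s).hasDerivWithinAt.smul (hTd s hs.1)
    have h0 : g s • -(a : ℂ) • T s x + (g s * a) • T s x = 0 := by
      rw [smul_smul, ← add_smul]
      simp
    rwa [h0] at this

theorem inner_apply_of_generates [CompleteSpace H] (e : HilbertBasis ι ℂ H) {lam : ι → ℝ}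
    {T : ℝ → H →L[ℂ] H}
    (hT : Generates (diagGraph e lam) T) {t : ℝ} (ht : 0 ≤ t) (x : H) (i : ι) :
    inner ℂ (e i) (T t x) = Complex.exp (-((lam i * t : ℝ) : ℂ)) * inner ℂ (e i) x := by
  classical
  have hon := orthonormal_iff_ite.1 e.orthonormal
  have hmem : ∀ j, (e j, -(lam j : ℂ) • e j) ∈ diagGraph e lam := by
    intro j k
    simp only [inner_smul_right, hon k j]
    split_ifs with h
    · rw [h]
    · simp
  have h1 := (e.hasSum_repr x).mapL (T t)
  have h2 := h1.mapL (innerSL ℂ (e i))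
  have h3 : HasSum (fun j => innerSL ℂ (e i) (T t (e.repr x j • e j)))
      (Complex.exp (-((lam i * t : ℝ) : ℂ)) * inner ℂ (e i) x) := by
    convert hasSum_ite_eq i (Complex.exp (-((lam i * t : ℝ) : ℂ)) * inner ℂ (e i) x) using 2
      with j
    rw [map_smul, hT.apply_eigenvector (hmem j) ht, innerSL_apply_apply, inner_smul_right,
      inner_smul_right, hon i j, e.repr_apply_apply]
    rcases eq_or_ne i j with h | h
    · subst h
      simp [mul_comm]
    · simp [h, h.symm]
  exact h2.unique h3

variable {c : ι → ℂ} {B : lp (fun _ : ι => ℂ) 2 → H}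

/-- Only finitely many coordinates are steered, since the control must undo the decay `exp (-lam i
(t₁ - s))`, which is not uniform in `i`. -/
theorem approximatelyControllable_diag [CompleteSpace H] (e : HilbertBasis ι ℂ H) {lam : ι → ℝ}
    (hlam : ∀ i, 0 ≤ lam i) (hc : ∀ i, c i ≠ 0)
    (hB : ∀ V i, inner ℂ (e i) (B V) = V i * c i) {t₁ : ℝ} (ht₁ : 0 < t₁) :
    ApproximatelyControllable (diagGraph e lam) B t₁ := by
  classical
  refine ⟨diagSemigroup e hlam, generates_diagSemigroup e hlam, fun z₀ z₁ ε hε => ?_⟩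
  set T := diagSemigroup e hlam
  have hon := orthonormal_iff_ite.1 e.orthonormal
  obtain ⟨F, hF⟩ : ∃ F : Finset ι,
      ‖∑ i ∈ F, e.repr (z₁ - T t₁ z₀) i • e i - (z₁ - T t₁ z₀)‖ < ε := by
    have := (Metric.tendsto_nhds.1 (e.hasSum_repr (z₁ - T t₁ z₀))) ε hε
    obtain ⟨F, hF⟩ := this.exists
    exact ⟨F, by rwa [dist_eq_norm] at hF⟩
  set a : ι → ℂ := fun i => e.repr (z₁ - T t₁ z₀) i
  have ht₁' : (t₁ : ℂ) ≠ 0 := by exact_mod_cast ht₁.ne'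
  -- Chosen so that `T (t₁ - s) (B (u s))` equals `t₁⁻¹ • ∑ a i • e i` for every `s`; integrating
  -- over `[0, t₁]` then gives the truncated target.
  let v : ℝ → ι → ℂ := fun s i =>
    a i / (c i * t₁) * Complex.exp ((lam i * (t₁ - s) : ℝ) : ℂ)
  let u : ℝ → lp (fun _ : ι => ℂ) 2 := fun s => ∑ i ∈ F, lp.single 2 i (v s i)
  have hu : Continuous u := by
    refine continuous_finsetSum _ fun i _ => ?_
    exact (lp.isometry_single i).continuous.comp (by fun_prop)
  have huc : ∀ s i, u s i = if i ∈ F then v s i else 0 := by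
    intro s i
    simp only [u, lp.coeFn_sum, Finset.sum_apply, lp.single_apply, Pi.single_apply]
    rw [Finset.sum_ite_eq F i]
  refine ⟨u, ?_, ?_⟩
  · obtain ⟨C, hC⟩ := (isCompact_Icc (a := (0 : ℝ)) (b := t₁)).exists_bound_of_continuousOn
      hu.continuousOn
    refine MemLp.of_bound hu.aestronglyMeasurable C ?_
    filter_upwards [ae_restrict_mem measurableSet_Ioc] with s hs
    exact hC s ⟨hs.1.le, hs.2⟩
  · have hint : ∀ s ∈ Set.uIcc 0 t₁,
        T (t₁ - s) (B (u s)) = (t₁⁻¹ : ℝ) • ∑ i ∈ F, a i • e i := by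
      intro s hs
      rw [Set.uIcc_of_le ht₁.le] at hs
      refine eq_of_forall_inner_eq e fun i => ?_
      rw [inner_diagSemigroup e hlam (sub_nonneg.2 hs.2), hB, huc, inner_smul_right_eq_smul,
        inner_sum]
      simp only [inner_smul_right, hon]
      simp only [mul_ite, mul_one, mul_zero, Finset.sum_ite_eq]
      split_ifs with h
      · simp only [v]
        rw [Complex.real_smul, Complex.ofReal_inv]
        have := hc i
        have h1 : Complex.exp (-((lam i * (t₁ - s) : ℝ) : ℂ)) *
            Complex.exp ((lam i * (t₁ - s) : ℝ) : ℂ) = 1 := by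
          rw [← Complex.exp_add, neg_add_cancel, Complex.exp_zero]
        field_simp
        linear_combination (a i) * h1
      · simp
    rw [mildSolution, intervalIntegral.integral_congr hint, intervalIntegral.integral_const,
      sub_zero, smul_smul, mul_inv_cancel₀ ht₁.ne', one_smul]
    refine le_of_eq_of_le ?_ hF.le
    congr 1
    abel

/-- Reachability of every state from `0` would make the functionals `(c i)⁻¹ ⟨e i, ·⟩` pointwise
bounded, hence uniformly bounded, which contradicts `c i → 0`. -/
theorem not_exactlyControllable_diag [Infinite ι] [CompleteSpace H] (e : HilbertBasis ι ℂ H)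
    {lam : ι → ℝ} (hlam : ∀ i, 0 ≤ lam i) (hc : ∀ i, c i ≠ 0) (hcs : Summable fun i => ‖c i‖ ^ 2)
    (hB : ∀ V i, inner ℂ (e i) (B V) = V i * c i) {t₁ : ℝ} (ht₁ : 0 < t₁) :
    ¬ ExactlyControllable (diagGraph e lam) B t₁ := by
  rintro ⟨T, hT, hex⟩
  have hbound : ∀ z : H, ∃ C, ∀ i, ‖((c i)⁻¹ • innerSL ℂ (e i)) z‖ ≤ C := by
    intro z
    obtain ⟨u, hu, hz⟩ := hex 0 z
    have hui : Integrable u (volume.restrict (Set.Ioc 0 t₁)) := hu.integrable (by norm_num)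
    refine ⟨∫ s in Set.Ioc 0 t₁, ‖u s‖, fun i => ?_⟩
    rw [mildSolution, map_zero, zero_add, intervalIntegral.integral_of_le ht₁.le] at hz
    simp only [_root_.smul_apply, innerSL_apply_apply, smul_eq_mul, norm_mul,
      norm_inv]
    rw [inv_mul_le_iff₀ (norm_pos_iff.2 (hc i)), ← hz]
    by_cases hint : Integrable (fun s => T (t₁ - s) (B (u s))) (volume.restrict (Set.Ioc 0 t₁))
    · rw [← innerSL_apply_apply, ← ContinuousLinearMap.integral_comp_comm _ hint,
        ← integral_const_mul]
      refine norm_integral_le_of_norm_le (hui.norm.const_mul _) ?_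
      filter_upwards [ae_restrict_mem measurableSet_Ioc] with s hs
      have hs' : 0 ≤ t₁ - s := sub_nonneg.2 hs.2
      rw [innerSL_apply_apply, inner_apply_of_generates e hT hs', hB, norm_mul, norm_mul,
        mul_comm ‖c i‖]
      refine (mul_le_of_le_one_left (by positivity)
        (norm_exp_neg_le_one (mul_nonneg (hlam i) hs'))).trans ?_
      gcongr
      exact lp.norm_apply_le_norm (by norm_num) (u s) i
    -- A non-integrable integrand has integral `0` by convention, so here `z = 0` and the bound is
    -- trivial.
    · rw [integral_undef hint, inner_zero_right, norm_zero]
      exact mul_nonneg (norm_nonneg _) (integral_nonneg fun _ => norm_nonneg _)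
  obtain ⟨C, hC⟩ := banach_steinhaus hbound
  have hC' : ∀ i, 1 ≤ C * ‖c i‖ := by
    intro i
    -- Testing the functional on `e i` itself shows that its norm is at least `‖c i‖⁻¹`.
    have := (ContinuousLinearMap.le_opNorm ((c i)⁻¹ • innerSL ℂ (e i)) (e i)).trans
      (mul_le_mul_of_nonneg_right (hC i) (norm_nonneg _))
    have hpos := norm_pos_iff.2 (hc i)
    rw [e.orthonormal.1 i, mul_one] at this
    simp only [_root_.smul_apply, innerSL_apply_apply, norm_smul, norm_inv,
      inner_self_eq_norm_sq_to_K, e.orthonormal.1 i] at this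
    simp only [RCLike.ofReal_one, one_pow, norm_one, mul_one] at this
    calc (1 : ℝ) = ‖c i‖⁻¹ * ‖c i‖ := (inv_mul_cancel₀ hpos.ne').symm
      _ ≤ C * ‖c i‖ := by gcongr
  have hlim : Tendsto (fun i => ‖c i‖) cofinite (𝓝 0) := by
    have := hcs.tendsto_cofinite_zero.sqrt
    simpa using this
  have := hlim.const_mul C
  rw [mul_zero] at this
  exact absurd (ge_of_tendsto this (Eventually.of_forall hC')) (by norm_num)

end DiagonalSystems

/-! ### Rodrigues polynomials of a Pearson weight -/

section Rodrigues

open Polynomial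

/-- The factor `q_k` in `(d/dx)^k (σ^n w) = σ^(n-k) w q_k` for a weight `w` with Pearson equation
`(σ w)' = τ w`. -/
def rodrigues (σ τ : ℝ[X]) (n : ℕ) : ℕ → ℝ[X]
  | 0 => 1
  | k + 1 => (C ((n : ℝ) - k - 1) * derivative σ + τ) * rodrigues σ τ n k +
      σ * derivative (rodrigues σ τ n k)

/-- The second order operator `σ ∂² + τ ∂` on polynomials. -/
def hypergeomDiff (σ τ p : ℝ[X]) : ℝ[X] :=
  σ * derivative (derivative p) + τ * derivative p

variable {σ τ : ℝ[X]}

/-- With `w' = w g` and `σ g = τ - σ'`, one differentiation turns `σ^(j+1) w q` into `σ^j w ((j σ' +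
τ) q + σ q')`, which is the recursion defining `rodrigues` with `j = n - k - 1`. -/
theorem iteratedDeriv_pearson {I : Set ℝ} (hI : IsOpen I) {w g : ℝ → ℝ}
    (hw : ∀ x ∈ I, HasDerivAt w (w x * g x) x)
    (hg : ∀ x ∈ I, σ.eval x * g x = τ.eval x - (derivative σ).eval x) (n : ℕ) :
    ∀ k ≤ n, ∀ x ∈ I, iteratedDeriv k (fun y => σ.eval y ^ n * w y) x =
      σ.eval x ^ (n - k) * w x * (rodrigues σ τ n k).eval x := by
  intro k
  induction k with
  | zero =>
    intro _ x _
    simp [rodrigues]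
  | succ k ih =>
    intro hk x hx
    obtain ⟨j, rfl⟩ : ∃ j, n = k + 1 + j := ⟨n - (k + 1), by omega⟩
    have h1 : iteratedDeriv k (fun y => σ.eval y ^ (k + 1 + j) * w y) =ᶠ[𝓝 x]
        fun y => σ.eval y ^ (j + 1) * w y * (rodrigues σ τ (k + 1 + j) k).eval y := by
      filter_upwards [hI.mem_nhds hx] with y hy
      rw [ih (by omega) y hy]
      congr 3
      omega
    rw [iteratedDeriv_succ, h1.deriv_eq]
    have h2 := (((σ.hasDerivAt x).pow (j + 1)).mul (hw x hx)).mul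
      ((rodrigues σ τ (k + 1 + j) k).hasDerivAt x)
    have h3 := h2.deriv
    simp only [Pi.mul_apply, Pi.pow_apply] at h3
    refine Eq.trans (congrArg (fun f => deriv f x) (funext fun y => by simp)) (h3.trans ?_)
    have h4 := hg x hx
    have h5 : k + 1 + j - (k + 1) = j := by omega
    rw [h5, rodrigues]
    simp only [eval_add, eval_mul, eval_C, Nat.add_sub_cancel]
    push_cast
    linear_combination (σ.eval x ^ j * w x * (rodrigues σ τ (k + 1 + j) k).eval x) * h4

variable (hσ : σ.natDegree ≤ 2) (hτ : τ.natDegree ≤ 1)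

include hσ hτ in
theorem natDegree_hypergeomDiff_le_and_coeff {p : ℝ[X]} {m : ℕ} (hp : p.natDegree ≤ m) :
    (hypergeomDiff σ τ p).natDegree ≤ m ∧
      (hypergeomDiff σ τ p).coeff m =
        ((m : ℝ) * (m - 1) * σ.coeff 2 + m * τ.coeff 1) * p.coeff m := by
  have hd1 : (derivative p).natDegree ≤ m - 1 := (natDegree_derivative_le p).trans (by omega)
  have hd2 : (derivative (derivative p)).natDegree ≤ m - 1 - 1 :=
    (natDegree_derivative_le _).trans (by omega)
  rcases m with _ | _ | m
  · rw [eq_C_of_natDegree_le_zero hp]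
    simp [hypergeomDiff]
  · have h0 : derivative (derivative p) = 0 := by
      rw [eq_C_of_natDegree_le_zero hd1, derivative_C]
    have h1 := coeff_mul_add_eq_of_natDegree_le hτ hd1
    have h2 := natDegree_mul_le_of_le hτ hd1
    simp only [Nat.add_zero, zero_add, Nat.sub_self] at h1 h2
    refine ⟨by simpa [hypergeomDiff, h0] using h2, ?_⟩
    simp [hypergeomDiff, h0, h1, coeff_derivative]
  · simp only [Nat.add_sub_cancel] at hd1 hd2
    have h1 := coeff_mul_add_eq_of_natDegree_le hτ hd1
    have h2 := natDegree_mul_le_of_le hτ hd1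
    have h3 := coeff_mul_add_eq_of_natDegree_le hσ hd2
    have h4 := natDegree_mul_le_of_le hσ hd2
    rw [show 1 + (m + 1) = m + 1 + 1 by ring] at h1 h2
    rw [show 2 + m = m + 1 + 1 by ring] at h3 h4
    refine ⟨natDegree_add_le_of_degree_le h4 h2, ?_⟩
    rw [hypergeomDiff, coeff_add, h1, h3, coeff_derivative, coeff_derivative]
    push_cast
    ring

include hσ hτ in
-- Step `k` multiplies the top coefficient by `2 (n - k - 1) σ₂ + τ₁` from the first summand and by
-- `k σ₂` from the second, together `(2 n - k - 2) σ₂ + τ₁`.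
theorem natDegree_rodrigues_le_and_coeff (n k : ℕ) :
    (rodrigues σ τ n k).natDegree ≤ k ∧ (rodrigues σ τ n k).coeff k =
      ∏ j ∈ Finset.range k, ((2 * (n : ℝ) - j - 2) * σ.coeff 2 + τ.coeff 1) := by
  induction k with
  | zero => simp [rodrigues]
  | succ k ih =>
    obtain ⟨ih1, ih2⟩ := ih
    have hA : (C ((n : ℝ) - k - 1) * derivative σ + τ).natDegree ≤ 1 :=
      natDegree_add_le_of_degree_le ((natDegree_C_mul_le _ _).trans
        ((natDegree_derivative_le σ).trans (by omega))) hτ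
    have h1 := coeff_mul_add_eq_of_natDegree_le hA ih1
    have h2 := natDegree_mul_le_of_le hA ih1
    rw [add_comm 1 k] at h1 h2
    have hA1 : (C ((n : ℝ) - k - 1) * derivative σ + τ).coeff 1 =
        ((n : ℝ) - k - 1) * (2 * σ.coeff 2) + τ.coeff 1 := by
      rw [coeff_add, coeff_C_mul, coeff_derivative]
      push_cast
      ring
    have h34 : (σ * derivative (rodrigues σ τ n k)).natDegree ≤ k + 1 ∧
        (σ * derivative (rodrigues σ τ n k)).coeff (k + 1) =
          σ.coeff 2 * (k * (rodrigues σ τ n k).coeff k) := by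
      rcases k with _ | k
      · simp [rodrigues]
      · have hd : (derivative (rodrigues σ τ n (k + 1))).natDegree ≤ k :=
          (natDegree_derivative_le _).trans (by omega)
        have h3 := coeff_mul_add_eq_of_natDegree_le hσ hd
        have h4 := natDegree_mul_le_of_le hσ hd
        rw [show 2 + k = k + 1 + 1 by ring] at h3 h4
        refine ⟨h4, ?_⟩
        rw [h3, coeff_derivative]
        push_cast
        ring
    rw [rodrigues]
    refine ⟨natDegree_add_le_of_degree_le h2 h34.1, ?_⟩
    rw [coeff_add, h1, h34.2, hA1, Finset.prod_range_succ, ← ih2]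
    ring

variable {E : ℝ[X] →ₗ[ℝ] ℝ} (hE : ∀ p, E (σ * derivative p + τ * p) = 0)

include hE in
-- The Pearson identity for `p' q`. The right side is symmetric in `p` and `q`, so the operator is
-- symmetric for the form `E (p q)`.
theorem map_hypergeomDiff_mul (p q : ℝ[X]) :
    E (hypergeomDiff σ τ p * q) = -E (σ * derivative p * derivative q) := by
  have h := hE (derivative p * q)
  rw [eq_neg_iff_add_eq_zero, ← map_add, ← h, hypergeomDiff, derivative_mul]
  congr 1
  ring

include hE in
-- Integration by parts `k` times. Each step is the Pearson identity for `σ ^ j * q_k * p`, so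
-- boundary terms never appear.
theorem map_rodrigues_mul_aux (n k : ℕ) (hk : k ≤ n) (p : ℝ[X]) :
    E (σ ^ (n - k) * rodrigues σ τ n k * p) = (-1) ^ k * E (σ ^ n * derivative^[k] p) := by
  induction k generalizing p with
  | zero => simp [rodrigues]
  | succ k ih =>
    obtain ⟨j, rfl⟩ : ∃ j, n = k + 1 + j := ⟨n - (k + 1), by omega⟩
    have ih' := ih (by omega) (derivative p)
    rw [show k + 1 + j - k = j + 1 by omega] at ih'
    rw [show k + 1 + j - (k + 1) = j by omega, Function.iterate_succ_apply, pow_succ,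
      mul_neg_one, neg_mul, ← ih', eq_neg_iff_add_eq_zero, ← map_add]
    refine Eq.trans (congrArg E ?_) (hE (σ ^ j * rodrigues σ τ (k + 1 + j) k * p))
    rw [rodrigues, derivative_mul, derivative_mul, derivative_pow]
    have hC : (C (((k + 1 + j : ℕ) : ℝ) - k - 1) : ℝ[X]) = (j : ℝ[X]) := by
      rw [← C_eq_natCast]
      congr 1
      push_cast
      ring
    rw [hC]
    rcases j with _ | j
    · simp
      ring
    · simp only [Nat.add_sub_cancel, C_eq_natCast]
      ring

include hE in
theorem map_rodrigues_mul (n : ℕ) (p : ℝ[X]) :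
    E (rodrigues σ τ n n * p) = (-1) ^ n * E (σ ^ n * derivative^[n] p) := by
  simpa using map_rodrigues_mul_aux hE n n le_rfl p

theorem iterate_derivative_eq_C {p : ℝ[X]} {n : ℕ} (hp : p.natDegree ≤ n) :
    derivative^[n] p = C ((n.factorial : ℝ) * p.coeff n) := by
  have h := natDegree_iterate_derivative p n
  rw [eq_C_of_natDegree_le_zero (h.trans (by omega)), coeff_iterate_derivative]
  simp [Nat.descFactorial_self]

include hE in
-- After `n` integrations by parts only the constant `p^(n) = n! p_n` is left. This contains both
-- the orthogonality to lower degrees and the value of the norm.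
theorem map_rodrigues_mul_of_natDegree_le {n : ℕ} {p : ℝ[X]} (hp : p.natDegree ≤ n) :
    E (rodrigues σ τ n n * p) = (-1) ^ n * (n.factorial * p.coeff n) * E (σ ^ n) := by
  rw [map_rodrigues_mul hE, iterate_derivative_eq_C hp, mul_comm (σ ^ n), C_mul', map_smul,
    smul_eq_mul]
  ring

include hE in
theorem map_rodrigues_mul_of_natDegree_lt {n : ℕ} {p : ℝ[X]} (hp : p.natDegree < n) :
    E (rodrigues σ τ n n * p) = 0 := by
  rw [map_rodrigues_mul_of_natDegree_le hE hp.le, coeff_eq_zero_of_natDegree_lt hp]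
  simp

include hσ hτ hE in
theorem map_rodrigues_mul_self (n : ℕ) :
    E (rodrigues σ τ n n * rodrigues σ τ n n) = (-1) ^ n * (n.factorial *
      ∏ j ∈ Finset.range n, ((2 * (n : ℝ) - j - 2) * σ.coeff 2 + τ.coeff 1)) * E (σ ^ n) := by
  obtain ⟨h1, h2⟩ := natDegree_rodrigues_le_and_coeff hσ hτ n n
  rw [map_rodrigues_mul_of_natDegree_le hE h1, h2]

variable (hne : ∀ n, E (rodrigues σ τ n n * rodrigues σ τ n n) ≠ 0)

include hσ hτ hE hne in
-- If the degree dropped below `n`, the polynomial would be orthogonal to itself, against `hne`.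
theorem natDegree_rodrigues_eq (n : ℕ) :
    (rodrigues σ τ n n).natDegree = n ∧ rodrigues σ τ n n ≠ 0 := by
  have hq : rodrigues σ τ n n ≠ 0 := fun h => hne n (by rw [h, mul_zero, map_zero])
  refine ⟨le_antisymm (natDegree_rodrigues_le_and_coeff hσ hτ n n).1 ?_, hq⟩
  by_contra! h
  exact hne n (map_rodrigues_mul_of_natDegree_lt hE h)

include hσ hτ hE hne in
theorem map_rodrigues_mul_of_ne {m n : ℕ} (hmn : m ≠ n) :
    E (rodrigues σ τ m m * rodrigues σ τ n n) = 0 := by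
  have hm := (natDegree_rodrigues_eq hσ hτ hE hne m).1
  have hn := (natDegree_rodrigues_eq hσ hτ hE hne n).1
  rcases hmn.lt_or_gt with h | h
  · rw [mul_comm]
    exact map_rodrigues_mul_of_natDegree_lt hE (by omega)
  · exact map_rodrigues_mul_of_natDegree_lt hE (by omega)

include hσ hτ hE hne in
-- The operator is symmetric and does not raise degrees, so the defect `r = D q - ev q` has degree
-- below `n` and is orthogonal to everything of degree below `n`. Such an `r` must vanish.
theorem hypergeomDiff_rodrigues (n : ℕ) :
    hypergeomDiff σ τ (rodrigues σ τ n n) =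
      C ((n : ℝ) * (n - 1) * σ.coeff 2 + n * τ.coeff 1) * rodrigues σ τ n n := by
  set q := rodrigues σ τ n n
  set ev := (n : ℝ) * (n - 1) * σ.coeff 2 + n * τ.coeff 1
  have hq : q.natDegree ≤ n := (natDegree_rodrigues_le_and_coeff hσ hτ n n).1
  obtain ⟨hD1, hD2⟩ := natDegree_hypergeomDiff_le_and_coeff hσ hτ hq
  by_contra hcon
  set r := hypergeomDiff σ τ q - C ev * q
  have hr0 : r ≠ 0 := sub_ne_zero.2 hcon
  have hrn : r.natDegree ≤ n :=
    (natDegree_sub_le _ _).trans (max_le hD1 ((natDegree_C_mul_le _ _).trans hq))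
  have hrc : r.coeff n = 0 := by
    rw [coeff_sub, hD2, coeff_C_mul, sub_self]
  have hrlt : r.natDegree < n := by
    refine lt_of_le_of_ne hrn fun h => hr0 ?_
    rw [← h] at hrc
    exact leadingCoeff_eq_zero.1 hrc
  have horth : ∀ p : ℝ[X], p.natDegree < n → E (r * p) = 0 := by
    intro p hp
    have h1 : E (hypergeomDiff σ τ q * p) = E (q * hypergeomDiff σ τ p) := by
      rw [map_hypergeomDiff_mul hE, mul_comm q, map_hypergeomDiff_mul hE]
      congr 2
      ring
    have h2 : (hypergeomDiff σ τ p).natDegree < n :=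
      (natDegree_hypergeomDiff_le_and_coeff hσ hτ le_rfl).1.trans_lt hp
    rw [sub_mul, map_sub, h1, map_rodrigues_mul_of_natDegree_lt hE h2, mul_assoc, C_mul', map_smul,
      map_rodrigues_mul_of_natDegree_lt hE hp, smul_zero, sub_zero]
  -- Pairing `r` with the Rodrigues polynomial of its own degree `m` gives `± m! * r_m * E (σ ^ m)`,
  -- which is nonzero when `r ≠ 0`. Positivity of `E` is not needed.
  have hm := horth (rodrigues σ τ r.natDegree r.natDegree)
    ((natDegree_rodrigues_le_and_coeff hσ hτ _ _).1.trans_lt hrlt)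
  rw [mul_comm, map_rodrigues_mul_of_natDegree_le hE le_rfl] at hm
  have hσn : E (σ ^ r.natDegree) ≠ 0 := fun h =>
    hne r.natDegree (by rw [map_rodrigues_mul_self hσ hτ hE, h, mul_zero])
  have hl : r.coeff r.natDegree ≠ 0 := leadingCoeff_ne_zero.2 hr0
  have hf : (r.natDegree.factorial : ℝ) ≠ 0 := by exact_mod_cast Nat.factorial_ne_zero _
  exact mul_ne_zero (mul_ne_zero (pow_ne_zero _ (by norm_num)) (mul_ne_zero hf hl)) hσn hm

/-- `P` is a sequence of orthonormal polynomials for `μ`, eigenvectors of `σ ∂² + τ ∂` with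
eigenvalues `-lam n ≤ 0`, and `μ` has an exponential moment. -/
structure IsClassicalSystem (μ : Measure ℝ) (σ τ : ℝ[X]) (P : ℕ → ℝ[X]) (lam : ℕ → ℝ) : Prop where
  span_eq_top : Submodule.span ℝ (Set.range P) = ⊤
  integral_mul : ∀ m n, ∫ x, (P m).eval x * (P n).eval x ∂μ = if m = n then 1 else 0
  eigen : ∀ n, hypergeomDiff σ τ (P n) = C (-lam n) * P n
  nonneg : ∀ n, 0 ≤ lam n
  exp_moment : ∃ c : ℝ, 0 < c ∧ ∀ n : ℕ, Integrable (fun x => |x| ^ n * Real.exp (c * |x|)) μ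

theorem integrable_eval_of_exp_moment {μ : Measure ℝ}
    (h : ∃ c : ℝ, 0 < c ∧ ∀ n : ℕ, Integrable (fun x => |x| ^ n * Real.exp (c * |x|)) μ)
    (p : ℝ[X]) : Integrable (fun x => p.eval x) μ := by
  obtain ⟨c, hc, h⟩ := h
  simp only [eval_eq_sum, Polynomial.sum]
  refine integrable_finsetSum _ fun n _ => Integrable.const_mul ?_ _
  refine (h n).mono' (by fun_prop) (Eventually.of_forall fun x => ?_)
  rw [norm_pow, Real.norm_eq_abs]
  exact le_mul_of_one_le_right (by positivity) (Real.one_le_exp (by positivity))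

/-- Integration of polynomials as a linear functional. -/
def polyIntegral {μ : Measure ℝ} (h : ∀ p : ℝ[X], Integrable (fun x => p.eval x) μ) :
    ℝ[X] →ₗ[ℝ] ℝ where
  toFun p := ∫ x, p.eval x ∂μ
  map_add' p q := by
    simp only [eval_add]
    exact integral_add (h p) (h q)
  map_smul' a p := by
    simp only [eval_smul, smul_eq_mul, RingHom.id_apply]
    exact integral_const_mul _ _

include hσ hτ in
-- Hypothesis `hκ` is `κ n ^ 2 * E (q_n ^ 2) = 1` with the norm written in closed form; it also
-- supplies the nonvanishing of the norms on which the preceding lemmas rest.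
theorem isClassicalSystem_rodrigues {μ : Measure ℝ}
    (hexp : ∃ c : ℝ, 0 < c ∧ ∀ n : ℕ, Integrable (fun x => |x| ^ n * Real.exp (c * |x|)) μ)
    (hμ : ∀ p : ℝ[X], ∫ x, (σ * derivative p + τ * p).eval x ∂μ = 0)
    (hev : ∀ n : ℕ, (n : ℝ) * (n - 1) * σ.coeff 2 + n * τ.coeff 1 ≤ 0) {κ : ℕ → ℝ}
    (hκ : ∀ n, κ n ^ 2 * ((-1) ^ n * (n.factorial *
      ∏ j ∈ Finset.range n, ((2 * (n : ℝ) - j - 2) * σ.coeff 2 + τ.coeff 1)) *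
        ∫ x, σ.eval x ^ n ∂μ) = 1) :
    IsClassicalSystem μ σ τ (fun n => C (κ n) * rodrigues σ τ n n)
      fun n => -((n : ℝ) * (n - 1) * σ.coeff 2 + n * τ.coeff 1) := by
  set E := polyIntegral (integrable_eval_of_exp_moment hexp) with hEdef
  have hE : ∀ p, E (σ * derivative p + τ * p) = 0 := hμ
  have hsq : ∀ n, κ n ^ 2 * E (rodrigues σ τ n n * rodrigues σ τ n n) = 1 := by
    intro n
    rw [map_rodrigues_mul_self hσ hτ hE]
    refine Eq.trans ?_ (hκ n)
    simp only [← eval_pow]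
    rfl
  have hne : ∀ n, E (rodrigues σ τ n n * rodrigues σ τ n n) ≠ 0 := fun n h => by
    have := hsq n
    rw [h, mul_zero] at this
    exact zero_ne_one this
  have hκ0 : ∀ n, κ n ≠ 0 := fun n h => by
    have := hsq n
    rw [h] at this
    simp at this
  refine ⟨?_, fun m n => ?_, fun n => ?_, fun n => neg_nonneg.2 (hev n), hexp⟩
  · let S : Polynomial.Sequence ℝ :=
      { elems' := fun n => C (κ n) * rodrigues σ τ n n
        degree_eq' := fun n => by
          obtain ⟨h1, h2⟩ := natDegree_rodrigues_eq hσ hτ hE hne n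
          rw [degree_C_mul (hκ0 n), degree_eq_natDegree h2, h1] }
    exact S.span fun n => (leadingCoeff_ne_zero.2 (S.ne_zero n)).isUnit
  · have h1 : ∫ x, (C (κ m) * rodrigues σ τ m m).eval x * (C (κ n) * rodrigues σ τ n n).eval x ∂μ =
        κ m * κ n * E (rodrigues σ τ m m * rodrigues σ τ n n) := by
      change _ = κ m * κ n * ∫ x, _ ∂μ
      rw [← integral_const_mul]
      congr 1
      ext x
      simp only [eval_mul, eval_C]
      ring
    rw [h1]
    split_ifs with h
    · rw [h, ← hsq n, sq]
    · rw [map_rodrigues_mul_of_ne hσ hτ hE hne h, mul_zero]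
  · have h1 : hypergeomDiff σ τ (C (κ n) * rodrigues σ τ n n) =
        C (κ n) * hypergeomDiff σ τ (rodrigues σ τ n n) := by
      simp only [hypergeomDiff, derivative_C_mul]
      ring
    rw [h1, hypergeomDiff_rodrigues hσ hτ hE hne, neg_neg]
    ring

end Rodrigues

/-! ### Density of polynomials under an exponential moment -/

section Density

/-- The positive and negative parts of `g` are densities of two finite measures with equal
characteristic functions, so the measures agree; then `g⁺ = g⁻` almost everywhere, which forces both
to vanish. -/
theorem ae_eq_zero_of_integral_mul_exp_eq_zero_real {V : Type*} [NormedAddCommGroup V]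
    [NormedSpace ℝ V] [MeasurableSpace V] [BorelSpace V] [SecondCountableTopology V]
    [CompleteSpace V] {μ : Measure V} {g : V → ℝ} (hg : Integrable g μ)
    (h : ∀ L : StrongDual ℝ V, ∫ x, (g x : ℂ) * Complex.exp (L x * Complex.I) ∂μ = 0) :
    g =ᵐ[μ] 0 := by
  have hgm := hg.aestronglyMeasurable.aemeasurable
  have hgn : AEMeasurable (fun x => -g x) μ := hgm.neg
  have hfin : ∀ g' : V → ℝ, Integrable g' μ → ∫⁻ x, ENNReal.ofReal (g' x) ∂μ ≠ ⊤ := fun g' hg' =>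
    (lt_of_le_of_lt (lintegral_mono fun x => Real.ofReal_le_enorm (g' x)) hg'.2).ne
  have h1 := hfin g hg
  have h2 := hfin (-g) hg.neg
  have : IsFiniteMeasure (μ.withDensity fun x => ENNReal.ofReal (g x)) :=
    isFiniteMeasure_withDensity h1
  have : IsFiniteMeasure (μ.withDensity fun x => ENNReal.ofReal (-g x)) :=
    isFiniteMeasure_withDensity h2
  have key : μ.withDensity (fun x => ENNReal.ofReal (g x)) =
      μ.withDensity (fun x => ENNReal.ofReal (-g x)) := by
    refine Measure.ext_of_charFunDual (funext fun L => ?_)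
    rw [charFunDual_apply, charFunDual_apply, integral_withDensity_eq_integral_toReal_smul₀
      hgm.ennreal_ofReal (Eventually.of_forall fun _ => ENNReal.ofReal_lt_top),
      integral_withDensity_eq_integral_toReal_smul₀
      hgn.ennreal_ofReal (Eventually.of_forall fun _ => ENNReal.ofReal_lt_top),
      ← sub_eq_zero]
    have hb : ∀ g' : V → ℝ, Integrable g' μ → Integrable
        (fun x => (ENNReal.ofReal (g' x)).toReal • Complex.exp (L x * Complex.I)) μ := by
      intro g' hg'
      refine hg'.norm.mono' ?_ (Eventually.of_forall fun x => ?_)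
      · exact hg'.aestronglyMeasurable.aemeasurable.ennreal_ofReal.ennreal_toReal
          |>.aestronglyMeasurable.smul (by fun_prop)
      · rw [norm_smul, Complex.norm_exp_ofReal_mul_I, mul_one, Real.norm_of_nonneg (by positivity),
          ENNReal.toReal_ofReal']
        exact max_le (le_abs_self _) (norm_nonneg _)
    rw [← integral_sub (hb g hg) (hb (fun x => -g x) hg.neg), ← h L]
    congr 1
    ext x
    rw [ENNReal.toReal_ofReal', ENNReal.toReal_ofReal', ← sub_smul, Complex.real_smul]
    congr 2
    rcases le_total (g x) 0 with hx | hx <;> simp [hx]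
  rw [withDensity_eq_iff hgm.ennreal_ofReal hgn.ennreal_ofReal h1] at key
  filter_upwards [key] with x hx
  rcases le_total (g x) 0 with h0 | h0
  · rw [ENNReal.ofReal_of_nonpos h0, eq_comm, ENNReal.ofReal_eq_zero] at hx
    exact le_antisymm h0 (neg_nonpos.1 hx)
  · rw [ENNReal.ofReal_of_nonpos (p := -g x) (by linarith), ENNReal.ofReal_eq_zero] at hx
    exact le_antisymm hx h0

/-- Injectivity of the Fourier transform on complex densities. -/
theorem ae_eq_zero_of_integral_mul_exp_eq_zero {V : Type*} [NormedAddCommGroup V]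
    [NormedSpace ℝ V] [MeasurableSpace V] [BorelSpace V] [SecondCountableTopology V]
    [CompleteSpace V] {μ : Measure V} {f : V → ℂ} (hf : Integrable f μ)
    (h : ∀ L : StrongDual ℝ V, ∫ x, f x * Complex.exp (L x * Complex.I) ∂μ = 0) :
    f =ᵐ[μ] 0 := by
  have hi : ∀ f' : V → ℂ, Integrable f' μ → ∀ L : StrongDual ℝ V,
      Integrable (fun x => f' x * Complex.exp (L x * Complex.I)) μ := by
    intro f' hf' L
    refine hf'.norm.mono' (hf'.aestronglyMeasurable.mul (by fun_prop))
      (Eventually.of_forall fun x => ?_)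
    rw [norm_mul, Complex.norm_exp_ofReal_mul_I, mul_one]
  have hcf : Integrable (fun x => starRingEnd ℂ (f x)) μ :=
    hf.norm.mono' (Complex.continuous_conj.comp_aestronglyMeasurable hf.aestronglyMeasurable)
      (Eventually.of_forall fun x => by simp)
  -- Conjugating the hypothesis at `-L` shows that the conjugate of `f` satisfies it too, so it
  -- passes to real and imaginary parts.
  have hconj : ∀ L : StrongDual ℝ V,
      ∫ x, starRingEnd ℂ (f x) * Complex.exp (L x * Complex.I) ∂μ = 0 := by
    intro L
    rw [← map_zero (starRingEnd ℂ), ← h (-L), ← integral_conj]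
    congr 1
    ext x
    rw [map_mul, ← Complex.exp_conj]
    simp
  have hre : (fun x => (f x).re) =ᵐ[μ] 0 := by
    refine ae_eq_zero_of_integral_mul_exp_eq_zero_real hf.re fun L => ?_
    calc ∫ x, ((f x).re : ℂ) * Complex.exp (L x * Complex.I) ∂μ
        = ∫ x, (1 / 2 : ℂ) * (f x * Complex.exp (L x * Complex.I) +
            starRingEnd ℂ (f x) * Complex.exp (L x * Complex.I)) ∂μ := by
          congr 1
          ext x
          rw [Complex.re_eq_add_conj]
          ring
      _ = 0 := by
          rw [integral_const_mul, integral_add (hi _ hf L) (hi _ hcf L), h L, hconj L]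
          simp
  have him : (fun x => (f x).im) =ᵐ[μ] 0 := by
    refine ae_eq_zero_of_integral_mul_exp_eq_zero_real hf.im fun L => ?_
    calc ∫ x, ((f x).im : ℂ) * Complex.exp (L x * Complex.I) ∂μ
        = ∫ x, (1 / (2 * Complex.I) : ℂ) * (f x * Complex.exp (L x * Complex.I) -
            starRingEnd ℂ (f x) * Complex.exp (L x * Complex.I)) ∂μ := by
          congr 1
          ext x
          rw [Complex.im_eq_sub_conj]
          ring
      _ = 0 := by
          rw [integral_const_mul, integral_sub (hi _ hf L) (hi _ hcf L), h L, hconj L]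
          simp
  filter_upwards [hre, him] with x h1 h2
  exact Complex.ext h1 h2

variable {d : ℕ}

theorem continuous_polyFun (p : MvPolynomial (Fin d) ℂ) : Continuous (polyFun p) := by
  unfold polyFun
  exact (MvPolynomial.continuous_eval p).comp (by fun_prop)

theorem polyFun_add (p q : MvPolynomial (Fin d) ℂ) (x : Fin d → ℝ) :
    polyFun (p + q) x = polyFun p x + polyFun q x := by simp [polyFun]

variable {μ : Measure (Fin d → ℝ)} {c : ℝ}
  (hexp : ∀ p : MvPolynomial (Fin d) ℂ,
    MemLp (fun x => polyFun p x * Real.exp (c * ∑ i, |x i|)) 2 μ)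

include hexp in
theorem memLp_polyFun (hc : 0 ≤ c) (p : MvPolynomial (Fin d) ℂ) : MemLp (polyFun p) 2 μ := by
  refine (hexp p).mono (continuous_polyFun p).aestronglyMeasurable
    (Eventually.of_forall fun x => ?_)
  rw [norm_mul, Complex.norm_real, Real.norm_of_nonneg (Real.exp_nonneg _)]
  exact le_mul_of_one_le_right (norm_nonneg _)
    (Real.one_le_exp (mul_nonneg hc (Finset.sum_nonneg fun _ _ => abs_nonneg _)))

include hexp in
-- Expand the exponential and integrate termwise: each term pairs `f` with a polynomial. The sum of
-- absolute values is at most `|f p| exp (c ∑ |x i|)`, a product of two `L²` functions because `|ξ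
-- i| ≤ c`.
theorem integral_mul_exp_mul_polyFun_of_small {f : (Fin d → ℝ) → ℂ} (hf : MemLp f 2 μ)
    (horth : ∀ p, ∫ x, f x * polyFun p x ∂μ = 0) {ξ : Fin d → ℝ} (hξ : ∀ i, |ξ i| ≤ c)
    (p : MvPolynomial (Fin d) ℂ) :
    ∫ x, f x * Complex.exp ((∑ i, ξ i * x i : ℝ) * Complex.I) * polyFun p x ∂μ = 0 := by
  let ℓ : MvPolynomial (Fin d) ℂ := ∑ i, MvPolynomial.C ((ξ i : ℝ) : ℂ) * MvPolynomial.X i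
  have hℓ : ∀ x, polyFun ℓ x = ((∑ i, ξ i * x i : ℝ) : ℂ) := fun x => by simp [ℓ, polyFun]
  have hbound : ∀ x : Fin d → ℝ, |∑ i, ξ i * x i| ≤ c * ∑ i, |x i| := by
    intro x
    refine (Finset.abs_sum_le_sum_abs _ _).trans ?_
    rw [Finset.mul_sum]
    refine Finset.sum_le_sum fun i _ => ?_
    rw [abs_mul]
    exact mul_le_mul_of_nonneg_right (hξ i) (abs_nonneg _)
  let F : ℕ → (Fin d → ℝ) → ℂ := fun k x =>
    f x * polyFun (MvPolynomial.C (Complex.I ^ k / k.factorial) * ℓ ^ k * p) x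
  have hF : ∀ k x, F k x =
      f x * polyFun p x * (((∑ i, ξ i * x i : ℝ) * Complex.I) ^ k / k.factorial) := by
    intro k x
    have : polyFun (MvPolynomial.C (Complex.I ^ k / k.factorial) * ℓ ^ k * p) x =
        Complex.I ^ k / k.factorial * (polyFun ℓ x) ^ k * polyFun p x := by
      simp only [polyFun, map_mul, map_pow, MvPolynomial.eval_C]
    simp only [F, this, hℓ]
    ring
  have hsum : HasSum (fun k => ∫ x, F k x ∂μ)
      (∫ x, f x * Complex.exp ((∑ i, ξ i * x i : ℝ) * Complex.I) * polyFun p x ∂μ) := by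
    have hreal : ∀ r : ℝ, HasSum (fun k : ℕ => r ^ k / k.factorial) (Real.exp r) := by
      intro r
      rw [Real.exp_eq_exp_ℝ]
      exact NormedSpace.expSeries_div_hasSum_exp r
    refine hasSum_integral_of_dominated_convergence
      (fun k x => ‖f x * polyFun p x‖ * (|∑ i, ξ i * x i| ^ k / k.factorial))
      (fun k => ?_) (fun k => Eventually.of_forall fun x => ?_)
      (Eventually.of_forall fun x => ((hreal _).mul_left _).summable) ?_
      (Eventually.of_forall fun x => ?_)
    · exact hf.aestronglyMeasurable.mul (continuous_polyFun _).aestronglyMeasurable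
    · rw [hF, norm_mul, norm_div, norm_pow, norm_mul _ Complex.I, Complex.norm_I, Complex.norm_real, mul_one]
      simp
    · simp only [((hreal _).mul_left _).tsum_eq]
      have h2 := hf.integrable_mul (hexp p)
      refine h2.norm.mono' ?_ (Eventually.of_forall fun x => ?_)
      · exact (hf.aestronglyMeasurable.mul (continuous_polyFun p).aestronglyMeasurable).norm.mul
          (Continuous.aestronglyMeasurable (by fun_prop))
      · simp only [Pi.mul_apply, norm_mul, norm_norm, Complex.norm_real]
        rw [Real.norm_of_nonneg (Real.exp_nonneg _), Real.norm_of_nonneg (Real.exp_nonneg _),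
          mul_assoc]
        gcongr
        exact hbound x
    · have h1 : HasSum (fun k : ℕ => ((∑ i, ξ i * x i : ℝ) * Complex.I) ^ k / k.factorial)
          (Complex.exp ((∑ i, ξ i * x i : ℝ) * Complex.I)) := by
        rw [Complex.exp_eq_exp_ℂ]
        exact NormedSpace.expSeries_div_hasSum_exp _
      simp only [hF]
      rw [mul_right_comm]
      exact h1.mul_left _
  have h0 : (fun k => ∫ x, F k x ∂μ) = fun _ => 0 := funext fun k => horth _
  rw [h0] at hsum
  exact hsum.unique hasSum_zero

include hexp in
-- Multiplying `f` by a small-frequency exponential keeps it in `L²` and orthogonal to all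
-- polynomials, so the small-frequency lemma can be iterated. That is why the polynomial factor is
-- carried along.
theorem integral_mul_exp_mul_polyFun_of_natMul {f : (Fin d → ℝ) → ℂ} (hf : MemLp f 2 μ)
    (horth : ∀ p, ∫ x, f x * polyFun p x ∂μ = 0) {ξ : Fin d → ℝ} (hξ : ∀ i, |ξ i| ≤ c) (n : ℕ) :
    ∀ p : MvPolynomial (Fin d) ℂ,
      ∫ x, f x * Complex.exp ((n * ∑ i, ξ i * x i : ℝ) * Complex.I) * polyFun p x ∂μ = 0 := by
  induction n with
  | zero => simpa using horth
  | succ n ih =>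
    intro p
    have hmem : MemLp (fun x => f x * Complex.exp ((n * ∑ i, ξ i * x i : ℝ) * Complex.I)) 2 μ := by
      refine hf.mono (hf.aestronglyMeasurable.mul
        (Continuous.aestronglyMeasurable (by fun_prop))) (Eventually.of_forall fun x => ?_)
      rw [norm_mul, Complex.norm_exp_ofReal_mul_I, mul_one]
    rw [← integral_mul_exp_mul_polyFun_of_small hexp hmem ih hξ p]
    congr 1
    ext x
    rw [mul_assoc (f x) (Complex.exp _) (Complex.exp _), ← Complex.exp_add]
    congr 3
    push_cast
    ring

include hexp in
/-- A finite measure with an exponential moment has dense polynomials in `L²`. -/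
theorem ae_eq_zero_of_orthogonal_polyFun [IsFiniteMeasure μ] (hc : 0 < c)
    {f : (Fin d → ℝ) → ℂ} (hf : MemLp f 2 μ)
    (horth : ∀ p, ∫ x, f x * polyFun p x ∂μ = 0) : f =ᵐ[μ] 0 := by
  refine ae_eq_zero_of_integral_mul_exp_eq_zero (hf.integrable (by norm_num)) fun L => ?_
  -- After division by `n` the coefficients of `L` are at most `c`, and `n` small steps reach `L`.
  obtain ⟨n, hn⟩ := exists_nat_gt (‖L‖ / c)
  have hn0 : (0 : ℝ) < n := lt_of_le_of_lt (by positivity) hn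
  have hL : ∀ x : Fin d → ℝ, L x = n * ∑ i, L (Pi.single i 1) / n * x i := by
    intro x
    rw [Finset.mul_sum]
    conv_lhs => rw [← Finset.univ_sum_single x, map_sum]
    refine Finset.sum_congr rfl fun i _ => ?_
    have : Pi.single i (x i) = x i • (Pi.single i 1 : Fin d → ℝ) := by
      rw [← Pi.single_smul, smul_eq_mul, mul_one]
    rw [this, map_smul, smul_eq_mul]
    field_simp
  have hξ : ∀ i, |L (Pi.single i 1) / n| ≤ c := by
    intro i
    rw [abs_div, abs_of_pos hn0, div_le_iff₀ hn0]
    rw [div_lt_iff₀ hc] at hn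
    refine le_trans ?_ (hn.le.trans_eq (mul_comm _ _))
    have := L.le_opNorm (Pi.single i 1)
    rwa [Pi.norm_single, norm_one, mul_one] at this
  have := integral_mul_exp_mul_polyFun_of_natMul hexp hf horth hξ n 1
  refine Eq.trans (integral_congr_ae (Eventually.of_forall fun x => ?_)) this
  simp only [polyFun, map_one, mul_one]
  rw [hL x]

end Density

/-! ### Products of one-variable systems -/

section Product

open Polynomial

variable {d : ℕ}

/-- A polynomial in one variable, evaluated at the variable `X i`. -/
def inVar (i : Fin d) (p : ℝ[X]) : MvPolynomial (Fin d) ℂ :=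
  aeval (MvPolynomial.X i) p

theorem polyFun_inVar (i : Fin d) (p : ℝ[X]) (x : Fin d → ℝ) :
    polyFun (inVar i p) x = ((p.eval (x i) : ℝ) : ℂ) := by
  induction p using Polynomial.induction_on' with
  | add p q hp hq =>
    rw [inVar, map_add, polyFun_add, eval_add, Complex.ofReal_add]
    exact congrArg₂ _ hp hq
  | monomial n a =>
    rw [inVar, aeval_monomial, IsScalarTower.algebraMap_apply ℝ ℂ (MvPolynomial (Fin d) ℂ)]
    simp [polyFun, MvPolynomial.algebraMap_eq]

theorem pderiv_inVar_self (i : Fin d) (p : ℝ[X]) :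
    MvPolynomial.pderiv i (inVar i p) = inVar i (derivative p) := by
  have : MvPolynomial.pderiv i (aeval (MvPolynomial.X i : MvPolynomial (Fin d) ℂ) p) =
      aeval (MvPolynomial.X i : MvPolynomial (Fin d) ℂ) (derivative p) •
        MvPolynomial.pderiv i (MvPolynomial.X i) :=
    ((MvPolynomial.pderiv (R := ℂ) i).restrictScalars ℝ).map_aeval p (MvPolynomial.X i)
  simpa [inVar] using this

theorem pderiv_inVar_of_ne {i j : Fin d} (hij : i ≠ j) (p : ℝ[X]) :
    MvPolynomial.pderiv j (inVar i p) = 0 := by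
  have : MvPolynomial.pderiv j (aeval (MvPolynomial.X i : MvPolynomial (Fin d) ℂ) p) =
      aeval (MvPolynomial.X i : MvPolynomial (Fin d) ℂ) (derivative p) •
        MvPolynomial.pderiv j (MvPolynomial.X i) :=
    ((MvPolynomial.pderiv (R := ℂ) j).restrictScalars ℝ).map_aeval p (MvPolynomial.X i)
  simpa [inVar, MvPolynomial.pderiv_X_of_ne hij] using this

theorem pderiv_prod_inVar_of_notMem {j : Fin d} {s : Finset (Fin d)} (hj : j ∉ s)
    (p : Fin d → ℝ[X]) : MvPolynomial.pderiv j (∏ i ∈ s, inVar i (p i)) = 0 := by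
  induction s using Finset.induction_on with
  | empty => simp
  | insert a s ha ih =>
    rw [Finset.mem_insert, not_or] at hj
    rw [Finset.prod_insert ha, Derivation.leibniz, ih hj.2, pderiv_inVar_of_ne (Ne.symm hj.1)]
    simp

/-- The operator `∑ᵢ [σᵢ(xᵢ) ∂ᵢ² + τᵢ(xᵢ) ∂ᵢ]` on polynomials. -/
def productDiff (σ τ : Fin d → ℝ[X]) : MvPolynomial (Fin d) ℂ →ₗ[ℂ] MvPolynomial (Fin d) ℂ where
  toFun p := ∑ i, (inVar i (σ i) * MvPolynomial.pderiv i (MvPolynomial.pderiv i p) +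
    inVar i (τ i) * MvPolynomial.pderiv i p)
  map_add' p q := by
    rw [← Finset.sum_add_distrib]
    refine Finset.sum_congr rfl fun i _ => ?_
    simp only [map_add]
    ring
  map_smul' a p := by
    rw [RingHom.id_apply, Finset.smul_sum]
    refine Finset.sum_congr rfl fun i _ => ?_
    simp only [Derivation.map_smul, mul_smul_comm, smul_add]

/-- The product `∏ᵢ P_{i, νᵢ}(xᵢ)` as a polynomial. -/
def productPoly (P : Fin d → ℕ → ℝ[X]) (ν : Fin d → ℕ) : MvPolynomial (Fin d) ℂ :=
  ∏ i, inVar i (P i (ν i))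

theorem polyFun_productPoly (P : Fin d → ℕ → ℝ[X]) (ν : Fin d → ℕ) (x : Fin d → ℝ) :
    polyFun (productPoly P ν) x = ((∏ i, (P i (ν i)).eval (x i) : ℝ) : ℂ) := by
  have h : polyFun (productPoly P ν) x = ∏ i, polyFun (inVar i (P i (ν i))) x := by
    simp [polyFun, productPoly, map_prod]
  rw [h, Complex.ofReal_prod]
  exact Finset.prod_congr rfl fun i _ => polyFun_inVar i _ x

/-- Separation of variables: `∂ᵢ` sees only the `i`-th factor, so each summand acts on that factor
as the one-variable operator and the eigenvalues add. -/
theorem productDiff_prod (σ τ p : Fin d → ℝ[X]) {a : Fin d → ℝ}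
    (h : ∀ i, hypergeomDiff (σ i) (τ i) (p i) = C (a i) * p i) :
    productDiff σ τ (∏ i, inVar i (p i)) = ((∑ i, a i : ℝ) : ℂ) • ∏ i, inVar i (p i) := by
  rw [Complex.ofReal_sum, Finset.sum_smul]
  change ∑ i, (inVar i (σ i) * MvPolynomial.pderiv i (MvPolynomial.pderiv i
    (∏ i, inVar i (p i))) + inVar i (τ i) * MvPolynomial.pderiv i (∏ i, inVar i (p i))) = _
  refine Finset.sum_congr rfl fun i _ => ?_
  have hR := pderiv_prod_inVar_of_notMem (Finset.notMem_erase i Finset.univ) p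
  rw [← Finset.mul_prod_erase Finset.univ (fun i => inVar i (p i)) (Finset.mem_univ i)]
  set R := ∏ j ∈ Finset.univ.erase i, inVar j (p j)
  have h1 : ∀ q : ℝ[X], MvPolynomial.pderiv i (inVar i q * R) = inVar i (derivative q) * R := by
    intro q
    rw [Derivation.leibniz, hR, pderiv_inVar_self, smul_zero, zero_add, smul_eq_mul, mul_comm]
  have h2 : inVar i (hypergeomDiff (σ i) (τ i) (p i)) =
      inVar i (σ i) * inVar i (derivative (derivative (p i))) +
        inVar i (τ i) * inVar i (derivative (p i)) := by
    simp only [inVar, hypergeomDiff, map_add, map_mul]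
  have h3 : inVar i (C (a i) * p i) = (a i : ℂ) • inVar i (p i) := by
    rw [inVar, map_mul, aeval_C, IsScalarTower.algebraMap_apply ℝ ℂ (MvPolynomial (Fin d) ℂ),
      ← Algebra.smul_def]
    rfl
  rw [h1, h1, ← smul_mul_assoc, ← h3, ← h i, h2]
  ring

variable {P : Fin d → ℕ → ℝ[X]}

theorem prod_inVar_mem_span (hP : ∀ i, Submodule.span ℝ (Set.range (P i)) = ⊤)
    (p : Fin d → ℝ[X]) :
    ∏ i, inVar i (p i) ∈ Submodule.span ℂ (Set.range (productPoly P)) := by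
  have h : ∀ i, ∃ c : ℕ →₀ ℝ, p i = ∑ n ∈ c.support, c n • P i n := by
    intro i
    have : p i ∈ Submodule.span ℝ (Set.range (P i)) := by rw [hP i]; trivial
    obtain ⟨c, hc⟩ := (Finsupp.mem_span_range_iff_exists_finsupp).1 this
    exact ⟨c, hc.symm⟩
  choose c hc using h
  have h1 : ∀ i, inVar i (p i) = ∑ n ∈ (c i).support, ((c i n : ℝ) : ℂ) • inVar i (P i n) := by
    intro i
    conv_lhs => rw [hc i]
    simp only [inVar, map_sum, map_smul]
    exact Finset.sum_congr rfl fun n _ => (algebraMap_smul ℂ (c i n) _).symm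
  simp only [h1]
  rw [Finset.prod_univ_sum]
  refine Submodule.sum_mem _ fun ν _ => ?_
  rw [Finset.prod_smul]
  exact Submodule.smul_mem _ _ (Submodule.subset_span ⟨ν, rfl⟩)

theorem span_productPoly_eq_top (hP : ∀ i, Submodule.span ℝ (Set.range (P i)) = ⊤) :
    Submodule.span ℂ (Set.range (productPoly P)) = ⊤ := by
  refine eq_top_iff.2 fun p _ => ?_
  induction p using MvPolynomial.induction_on' with
  | add p q hp hq => exact Submodule.add_mem _ (hp trivial) (hq trivial)
  | monomial u a =>
    have : MvPolynomial.monomial u a = a • ∏ i, inVar i (X ^ u i : ℝ[X]) := by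
      rw [MvPolynomial.monomial_eq, ← MvPolynomial.smul_eq_C_mul,
        Finsupp.prod_fintype _ _ (by simp)]
      simp [inVar]
    rw [this]
    exact Submodule.smul_mem _ _ (prod_inVar_mem_span hP _)

/-- For a monomial the squared norm factors into one-variable moments. Squaring doubles the
exponential rate, whence `2 * c' ≤ c i`. -/
theorem memLp_polyFun_mul_exp_pi {μ : Fin d → Measure ℝ} [∀ i, SigmaFinite (μ i)] {c : Fin d → ℝ}
    (h : ∀ i (n : ℕ), Integrable (fun x => |x| ^ n * Real.exp (c i * |x|)) (μ i)) {c' : ℝ}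
    (hc : ∀ i, 2 * c' ≤ c i) (p : MvPolynomial (Fin d) ℂ) :
    MemLp (fun x => polyFun p x * Real.exp (c' * ∑ i, |x i|)) 2 (Measure.pi μ) := by
  induction p using MvPolynomial.induction_on' with
  | add p q hp hq =>
    simp only [polyFun_add, add_mul]
    exact hp.add hq
  | monomial u a =>
    have hc1 : Continuous fun x : Fin d → ℝ => (Real.exp (c' * ∑ i, |x i|) : ℂ) := by fun_prop
    have hm : AEStronglyMeasurable (fun x => polyFun (MvPolynomial.monomial u a) x *
        (Real.exp (c' * ∑ i, |x i|) : ℂ)) (Measure.pi μ) :=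
      ((continuous_polyFun _).mul hc1).aestronglyMeasurable
    rw [memLp_two_iff_integrable_sq_norm hm]
    have h1 : ∀ i, Integrable (fun x => |x| ^ (2 * u i) * Real.exp (2 * c' * |x|)) (μ i) := by
      intro i
      refine (h i (2 * u i)).mono' (by fun_prop) (Eventually.of_forall fun x => ?_)
      rw [Real.norm_of_nonneg (by positivity)]
      gcongr
      exact hc i
    refine ((Integrable.fintype_prod h1).const_mul (‖a‖ ^ 2)).congr
      (Eventually.of_forall fun x => ?_)
    have h2 : polyFun (MvPolynomial.monomial u a) x = a * ∏ i, ((x i : ℝ) : ℂ) ^ u i := by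
      rw [polyFun, MvPolynomial.eval_monomial, Finsupp.prod_fintype _ _ (by simp)]
    simp only [h2]
    rw [norm_mul, norm_mul, norm_prod, Complex.norm_real, Real.norm_of_nonneg (Real.exp_nonneg _),
      mul_pow, mul_pow, ← Real.exp_nat_mul, Finset.prod_mul_distrib, ← Real.exp_sum,
      ← Finset.prod_pow, mul_assoc]
    congr 2
    · refine Finset.prod_congr rfl fun i _ => ?_
      rw [norm_pow, Complex.norm_real, Real.norm_eq_abs, ← pow_mul, mul_comm 2]
    · rw [← Finset.mul_sum]
      push_cast
      rw [mul_assoc]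

variable {μ : Fin d → Measure ℝ} [∀ i, IsFiniteMeasure (μ i)] {σ τ : Fin d → ℝ[X]}
  {lam : Fin d → ℕ → ℝ}

theorem exists_memLp_polyFun_mul_exp_pi
    (h : ∀ i, ∃ c : ℝ, 0 < c ∧
      ∀ n : ℕ, Integrable (fun x => |x| ^ n * Real.exp (c * |x|)) (μ i)) :
    ∃ c : ℝ, 0 < c ∧ ∀ p : MvPolynomial (Fin d) ℂ,
      MemLp (fun x => polyFun p x * Real.exp (c * ∑ i, |x i|)) 2 (Measure.pi μ) := by
  choose c hc h using h
  have h1 : ∀ᶠ c' : ℝ in 𝓝[>] 0, ∀ i, 2 * c' ≤ c i := by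
    refine eventually_all.2 fun i => ?_
    filter_upwards [Ioo_mem_nhdsGT (half_pos (hc i))] with c' hc'
    linarith [hc'.2]
  obtain ⟨c', h2, h3⟩ := (h1.and self_mem_nhdsWithin).exists
  exact ⟨c', h3, memLp_polyFun_mul_exp_pi h h2⟩

theorem memLp_polyFun_pi (h : ∀ i, IsClassicalSystem (μ i) (σ i) (τ i) (P i) (lam i))
    (p : MvPolynomial (Fin d) ℂ) : MemLp (polyFun p) 2 (Measure.pi μ) := by
  obtain ⟨c, hc, hexp⟩ := exists_memLp_polyFun_mul_exp_pi fun i => (h i).exp_moment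
  exact memLp_polyFun hexp hc.le p

/-- The class of a polynomial in `L²`. -/
def polyL2 {m : Measure (Fin d → ℝ)} (h : ∀ p : MvPolynomial (Fin d) ℂ, MemLp (polyFun p) 2 m) :
    MvPolynomial (Fin d) ℂ →ₗ[ℂ] Lp ℂ 2 m where
  toFun p := (h p).toLp (polyFun p)
  map_add' p q := by
    rw [← MemLp.toLp_add]
    exact MemLp.toLp_congr _ _ (Eventually.of_forall fun x => polyFun_add p q x)
  map_smul' a p := by
    rw [RingHom.id_apply, ← MemLp.toLp_const_smul]
    exact MemLp.toLp_congr _ _ (Eventually.of_forall fun x => by simp [polyFun])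

theorem inner_polyL2_productPoly {m : Measure (Fin d → ℝ)}
    (h : ∀ p : MvPolynomial (Fin d) ℂ, MemLp (polyFun p) 2 m) (ν : Fin d → ℕ) (f : Lp ℂ 2 m) :
    inner ℂ (polyL2 h (productPoly P ν)) f =
      ∫ x, f x * ((∏ i, (P i (ν i)).eval (x i) : ℝ) : ℂ) ∂m := by
  rw [L2.inner_def]
  refine integral_congr_ae ?_
  filter_upwards [(h (productPoly P ν)).coeFn_toLp] with x hx
  change inner ℂ ((h (productPoly P ν)).toLp _ x) (f x) = _
  rw [hx, polyFun_productPoly, RCLike.inner_apply, Complex.conj_ofReal]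

theorem orthonormal_polyL2_productPoly
    (h : ∀ i, IsClassicalSystem (μ i) (σ i) (τ i) (P i) (lam i)) :
    Orthonormal ℂ fun ν => polyL2 (memLp_polyFun_pi h) (productPoly P ν) := by
  rw [orthonormal_iff_ite]
  intro ν κ
  rw [inner_polyL2_productPoly]
  have h1 : ∫ x, polyL2 (memLp_polyFun_pi h) (productPoly P κ) x *
      ((∏ i, (P i (ν i)).eval (x i) : ℝ) : ℂ) ∂(Measure.pi μ) =
      ∫ x, ((∏ i, (P i (ν i)).eval (x i) * (P i (κ i)).eval (x i) : ℝ) : ℂ) ∂(Measure.pi μ) := by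
    refine integral_congr_ae ?_
    filter_upwards [(memLp_polyFun_pi h (productPoly P κ)).coeFn_toLp] with x hx
    change (memLp_polyFun_pi h (productPoly P κ)).toLp _ x * _ = _
    rw [hx, polyFun_productPoly, Finset.prod_mul_distrib, Complex.ofReal_mul, mul_comm]
  rw [h1, integral_complex_ofReal,
    integral_fintype_prod_eq_prod fun i y => (P i (ν i)).eval y * (P i (κ i)).eval y]
  simp only [(h _).integral_mul]
  split_ifs with hνκ
  · simp [hνκ]
  · obtain ⟨i, hi⟩ := Function.ne_iff.1 hνκ
    rw [Finset.prod_eq_zero (Finset.mem_univ i) (by rw [if_neg hi]), Complex.ofReal_zero]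

/-- The Hilbert basis of products of orthonormal polynomials. -/
def productBasis (h : ∀ i, IsClassicalSystem (μ i) (σ i) (τ i) (P i) (lam i)) :
    HilbertBasis (Fin d → ℕ) ℂ (Lp ℂ 2 (Measure.pi μ)) :=
  HilbertBasis.mkOfOrthogonalEqBot (orthonormal_polyL2_productPoly h) (by
    refine (Submodule.eq_bot_iff _).2 fun f hf => ?_
    obtain ⟨c, hc, hexp⟩ := exists_memLp_polyFun_mul_exp_pi fun i => (h i).exp_moment
    -- Orthogonality to the products extends by linearity to all polynomials; the density theorem
    -- then applies to the conjugate of `f`.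
    have h1 : (innerSL ℂ f).toLinearMap ∘ₗ polyL2 (memLp_polyFun_pi h) = 0 := by
      refine LinearMap.ext_on (span_productPoly_eq_top fun i => (h i).span_eq_top) ?_
      rintro _ ⟨ν, rfl⟩
      exact inner_eq_zero_symm.1
        ((Submodule.mem_orthogonal _ _).1 hf _ (Submodule.subset_span ⟨ν, rfl⟩))
    have h2 : ∀ p, ∫ x, starRingEnd ℂ (f x) * polyFun p x ∂(Measure.pi μ) = 0 := by
      intro p
      rw [← LinearMap.zero_apply (σ₁₂ := RingHom.id ℂ) (M₂ := ℂ) p, ← h1]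
      change _ = inner ℂ f (polyL2 (memLp_polyFun_pi h) p)
      rw [L2.inner_def]
      refine integral_congr_ae ?_
      filter_upwards [(memLp_polyFun_pi h p).coeFn_toLp] with x hx
      change _ = inner ℂ (f x) ((memLp_polyFun_pi h p).toLp _ x)
      rw [hx, RCLike.inner_apply, mul_comm]
    have hfc : MemLp (fun x => starRingEnd ℂ (f x)) 2 (Measure.pi μ) :=
      (Lp.memLp f).mono (Complex.continuous_conj.comp_aestronglyMeasurable
        (Lp.aestronglyMeasurable f)) (Eventually.of_forall fun x => by simp)
    have h3 := ae_eq_zero_of_orthogonal_polyFun hexp hc hfc h2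
    refine (Lp.eq_zero_iff_ae_eq_zero).2 ?_
    filter_upwards [h3] with x hx
    simpa using hx)

theorem productBasis_apply (h : ∀ i, IsClassicalSystem (μ i) (σ i) (τ i) (P i) (lam i))
    (ν : Fin d → ℕ) :
    productBasis h ν = polyL2 (memLp_polyFun_pi h) (productPoly P ν) := by
  rw [productBasis, HilbertBasis.coe_mkOfOrthogonalEqBot]

theorem isClosed_diagGraph {ι H : Type*} [NormedAddCommGroup H] [InnerProductSpace ℂ H]
    (e : HilbertBasis ι ℂ H) (lam : ι → ℝ) : IsClosed (diagGraph e lam) := by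
  simp only [diagGraph, Set.ofPred_forall]
  exact isClosed_iInter fun i => isClosed_eq (by fun_prop) (by fun_prop)

/-- The diagonal graph is closed and contains the polynomial pairs, which by linearity is checked on
products. Conversely the partial sums of the expansions of `z` and `w` are such pairs and converge
to `(z, w)`. -/
theorem closedOperator_productDiff
    (h : ∀ i, IsClassicalSystem (μ i) (σ i) (τ i) (P i) (lam i)) :
    closedOperator (Measure.pi μ) (productDiff σ τ) =
      diagGraph (productBasis h) fun ν => ∑ i, lam i (ν i) := by
  set J := polyL2 (memLp_polyFun_pi h)
  set e := productBasis h
  have hJ : ∀ (q : Lp ℂ 2 (Measure.pi μ)) p, q =ᵐ[Measure.pi μ] polyFun p ↔ q = J p := by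
    intro q p
    have h1 := (memLp_polyFun_pi h p).coeFn_toLp
    exact ⟨fun hq => Lp.ext (hq.trans h1.symm), fun hq => by rw [hq]; exact h1⟩
  have heig : ∀ ν, productDiff σ τ (productPoly P ν) =
      (-((∑ i, lam i (ν i) : ℝ) : ℂ)) • productPoly P ν := by
    intro ν
    rw [productPoly, productDiff_prod σ τ _ fun i => (h i).eigen (ν i), Finset.sum_neg_distrib,
      Complex.ofReal_neg]
  have heJ : ∀ ν, e ν = J (productPoly P ν) := productBasis_apply h
  simp only [closedOperator, hJ]
  refine Set.Subset.antisymm (closure_minimal ?_ (isClosed_diagGraph _ _)) ?_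
  · rintro ⟨_, _⟩ ⟨p, rfl, rfl⟩ ν
    have hon := orthonormal_iff_ite.1 e.orthonormal
    have : (innerSL ℂ (e ν)).toLinearMap ∘ₗ J ∘ₗ productDiff σ τ =
        (-((∑ i, lam i (ν i) : ℝ) : ℂ)) • ((innerSL ℂ (e ν)).toLinearMap ∘ₗ J) := by
      refine LinearMap.ext_on (span_productPoly_eq_top fun i => (h i).span_eq_top) ?_
      rintro _ ⟨κ, rfl⟩
      simp only [LinearMap.comp_apply, heig, map_smul, LinearMap.smul_apply, ← heJ]
      change _ • inner ℂ (e ν) (e κ) = _ • inner ℂ (e ν) (e κ)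
      rw [hon]
      split_ifs with hνκ
      · rw [hνκ]
      · simp
    exact LinearMap.congr_fun this p
  · rintro ⟨z, w⟩ hzw
    have h1 := (e.hasSum_repr z).prodMk_nhds (e.hasSum_repr w)
    refine mem_closure_of_tendsto h1 (Eventually.of_forall fun F => ?_)
    refine ⟨∑ ν ∈ F, e.repr z ν • productPoly P ν, ?_, ?_⟩
    · simp only [map_sum, map_smul, heJ]
    · simp only [map_sum, map_smul, heig, heJ]
      refine Finset.sum_congr rfl fun ν _ => ?_
      have := hzw ν
      dsimp only at this
      rw [e.repr_apply_apply, this, ← e.repr_apply_apply, smul_smul, mul_comm]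

/-- Controllability for products of classical orthogonal polynomials. -/
theorem controllability_of_isClassicalSystem (hd : 0 < d)
    (h : ∀ i, IsClassicalSystem (μ i) (σ i) (τ i) (P i) (lam i))
    {e : (Fin d → ℕ) → (Fin d → ℝ) → ℝ}
    (he : ∀ ν, e ν =ᵐ[Measure.pi μ] fun x => ∏ i, (P i (ν i)).eval (x i))
    {b : Lp ℂ 2 (Measure.pi μ)} (hb : ∀ ν, fourierCoef (Measure.pi μ) e b ν ≠ 0)
    {t₁ : ℝ} (ht₁ : 0 < t₁) :
    ApproximatelyControllable (closedOperator (Measure.pi μ) (productDiff σ τ))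
        (controlOperator (Measure.pi μ) e b) t₁ ∧
      ¬ ExactlyControllable (closedOperator (Measure.pi μ) (productDiff σ τ))
        (controlOperator (Measure.pi μ) e b) t₁ := by
  rw [closedOperator_productDiff h]
  set B := productBasis h
  have hL2 : ∀ ν, toL2 (Measure.pi μ) (e ν) = B ν := by
    intro ν
    have h1 : polyFun (productPoly P ν) =ᵐ[Measure.pi μ] fun x => (e ν x : ℂ) := by
      filter_upwards [he ν] with x hx
      rw [hx, polyFun_productPoly]
    have h2 := (memLp_polyFun_pi h (productPoly P ν)).ae_eq h1
    rw [toL2, dif_pos h2, productBasis_apply]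
    exact MemLp.toLp_congr h2 (memLp_polyFun_pi h _) h1.symm
  have hcoef : ∀ ν, fourierCoef (Measure.pi μ) e b ν = inner ℂ (B ν) b := by
    intro ν
    rw [productBasis_apply, inner_polyL2_productPoly, fourierCoef]
    refine integral_congr_ae ?_
    filter_upwards [he ν] with x hx
    rw [hx]
  set c := fourierCoef (Measure.pi μ) e b
  have hcs : Summable fun ν => ‖c ν‖ ^ 2 := by
    simpa only [hcoef] using (hasSum_norm_sq_inner B b).summable
  have hcle : ∀ ν, ‖c ν‖ ≤ ‖b‖ := fun ν => by
    rw [hcoef]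
    exact (norm_inner_le_norm _ _).trans (by rw [B.orthonormal.1 ν, one_mul])
  have hB : ∀ V ν, inner ℂ (B ν) (controlOperator (Measure.pi μ) e b V) = V ν * c ν := by
    intro V ν
    -- The coefficients are bounded by `‖b‖`, so `V κ * c κ` is square summable; the series for the
    -- control operator therefore converges and its coordinates can be read off.
    have hmem : Memℓp (fun κ => V κ * c κ) 2 := by
      refine ((lp.memℓp V).const_mul (‖b‖ : ℂ)).mono' fun κ => ?_
      rw [norm_mul, norm_mul, Complex.norm_real, norm_norm, mul_comm]
      gcongr
      exact hcle κ
    have h1 := B.hasSum_repr_symm ⟨_, hmem⟩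
    rw [controlOperator]
    simp only [hL2]
    rw [h1.tsum_eq, ← B.repr_apply_apply, LinearIsometryEquiv.apply_symm_apply]
  have hlam : ∀ ν : Fin d → ℕ, 0 ≤ ∑ i, lam i (ν i) := fun ν =>
    Finset.sum_nonneg fun i _ => (h i).nonneg _
  -- Makes the set of multi-indices infinite, as the negative result requires.
  have : Nonempty (Fin d) := ⟨⟨0, hd⟩⟩
  exact ⟨approximatelyControllable_diag B hlam hb hB ht₁,
    not_exactlyControllable_diag B hlam hb hcs hB ht₁⟩

end Product

/-! ### The Laguerre system -/

section LaguerreSystem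

open Polynomial

theorem integral_restrict_withDensity {S : Set ℝ} (hS : MeasurableSet S) {w : ℝ → ℝ}
    (hw : Measurable w) (h0 : ∀ x ∈ S, 0 ≤ w x) (f : ℝ → ℝ) :
    ∫ x, f x ∂((volume.restrict S).withDensity fun x => ENNReal.ofReal (w x)) =
      ∫ x in S, w x * f x := by
  rw [integral_withDensity_eq_integral_toReal_smul hw.ennreal_ofReal
    (Eventually.of_forall fun _ => ENNReal.ofReal_lt_top)]
  refine setIntegral_congr_fun hS fun x hx => ?_
  simp only [ENNReal.toReal_ofReal (h0 x hx), smul_eq_mul]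

theorem integrable_restrict_withDensity_iff {S : Set ℝ} (hS : MeasurableSet S) {w : ℝ → ℝ}
    (hw : Measurable w) (h0 : ∀ x ∈ S, 0 ≤ w x) (f : ℝ → ℝ) :
    Integrable f ((volume.restrict S).withDensity fun x => ENNReal.ofReal (w x)) ↔
      IntegrableOn (fun x => w x * f x) S := by
  rw [integrable_withDensity_iff_integrable_smul' hw.ennreal_ofReal
    (Eventually.of_forall fun _ => ENNReal.ofReal_lt_top)]
  refine integrableOn_congr_fun (fun x hx => ?_) hS
  simp only [ENNReal.toReal_ofReal (h0 x hx), smul_eq_mul]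

theorem isFiniteMeasure_of_exp_moment {μ : Measure ℝ}
    (h : ∃ c : ℝ, 0 < c ∧ ∀ n : ℕ, Integrable (fun x => |x| ^ n * Real.exp (c * |x|)) μ) :
    IsFiniteMeasure μ := by
  have := integrable_eval_of_exp_moment h 1
  simpa [integrable_const_iff] using this

/-- The normalized Gamma measure `x^a e^(-x) / Γ(a + 1) dx` on `ℝ₊`. -/
def laguerreMeasure1 (a : ℝ) : Measure ℝ :=
  (volume.restrict (Set.Ioi (0 : ℝ))).withDensity fun x =>
    ENNReal.ofReal (x ^ a * Real.exp (-x) / Real.Gamma (a + 1))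

variable {a : ℝ}

theorem laguerreMeasure1_density_nonneg (ha : -1 < a) :
    ∀ x ∈ Set.Ioi (0 : ℝ), 0 ≤ x ^ a * Real.exp (-x) / Real.Gamma (a + 1) := fun x hx =>
  div_nonneg (mul_nonneg (Real.rpow_nonneg (le_of_lt hx) _) (Real.exp_nonneg _))
    (Real.Gamma_pos_of_pos (by linarith)).le

theorem exp_moment_laguerreMeasure1 (ha : -1 < a) : ∃ c : ℝ, 0 < c ∧
    ∀ n : ℕ, Integrable (fun x => |x| ^ n * Real.exp (c * |x|)) (laguerreMeasure1 a) := by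
  -- Any rate below `1` would do: half of the decay `exp (-x)` is kept for integrability.
  refine ⟨1 / 2, by norm_num, fun n => ?_⟩
  rw [laguerreMeasure1, integrable_restrict_withDensity_iff measurableSet_Ioi (by fun_prop)
    (laguerreMeasure1_density_nonneg ha)]
  have hn : (0 : ℝ) ≤ n := n.cast_nonneg
  have h := (integrableOn_rpow_mul_exp_neg_mul_rpow (p := 1) (s := a + n) (b := 1 / 2)
    (by linarith) one_pos (by norm_num)).const_mul (Real.Gamma (a + 1))⁻¹
  refine (integrableOn_congr_fun (fun x hx => ?_) measurableSet_Ioi).1 h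
  have hx' : (0 : ℝ) < x := hx
  simp only [abs_of_pos hx', Real.rpow_one]
  rw [Real.rpow_add hx', Real.rpow_natCast,
    show -(1 / 2) * x = -x + 1 / 2 * x by ring, Real.exp_add]
  ring

theorem integral_pow_laguerreMeasure1 (ha : -1 < a) (n : ℕ) :
    ∫ x, x ^ n ∂(laguerreMeasure1 a) = Real.Gamma (n + a + 1) / Real.Gamma (a + 1) := by
  have hn : (0 : ℝ) ≤ n := n.cast_nonneg
  rw [laguerreMeasure1, integral_restrict_withDensity measurableSet_Ioi (by fun_prop)
    (laguerreMeasure1_density_nonneg ha), Real.Gamma_eq_integral (s := n + a + 1) (by linarith),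
    ← integral_div]
  refine setIntegral_congr_fun measurableSet_Ioi fun x hx => ?_
  have hx' : (0 : ℝ) < x := hx
  rw [show (n : ℝ) + a + 1 - 1 = a + n by ring, Real.rpow_add hx', Real.rpow_natCast]
  ring

/-- On monomials this is the recursion `Γ(s + 1) = s Γ(s)` at `s = n + a + 1` for consecutive
moments, which replaces an integration by parts with boundary terms. -/
theorem integral_pearson_laguerreMeasure1 (ha : -1 < a) (p : ℝ[X]) :
    ∫ x, (X * derivative p + (C (a + 1) - X) * p).eval x ∂(laguerreMeasure1 a) = 0 := by
  have hi := integrable_eval_of_exp_moment (exp_moment_laguerreMeasure1 ha)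
  induction p using Polynomial.induction_on' with
  | add p q hp hq =>
    have h := integral_add (hi (X * derivative p + (C (a + 1) - X) * p))
      (hi (X * derivative q + (C (a + 1) - X) * q))
    rw [hp, hq, add_zero] at h
    rw [← h]
    congr 1
    ext x
    rw [← eval_add, derivative_add]
    congr 1
    ring
  | monomial n r =>
    have h1 : ∀ x : ℝ, (X * derivative (monomial n r) + (C (a + 1) - X) * monomial n r).eval x =
        r * (n + a + 1) * x ^ n - r * x ^ (n + 1) := by
      intro x
      rcases n with _ | n
      · simp
        ring
      · simp
        ring
    have hpow : ∀ k : ℕ, Integrable (fun x : ℝ => x ^ k) (laguerreMeasure1 a) := fun k => by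
      simpa using hi (X ^ k)
    have hn : (0 : ℝ) ≤ n := n.cast_nonneg
    simp only [h1]
    rw [integral_sub ((hpow n).const_mul _) ((hpow (n + 1)).const_mul _), integral_const_mul,
      integral_const_mul, integral_pow_laguerreMeasure1 ha, integral_pow_laguerreMeasure1 ha]
    have h2 := Real.Gamma_add_one (s := n + a + 1) (by linarith)
    push_cast
    rw [show (n : ℝ) + 1 + a + 1 = n + a + 1 + 1 by ring, h2]
    ring

/-- The normalization of the one-dimensional Laguerre polynomials. -/
def laguerreConst (a : ℝ) (n : ℕ) : ℝ :=
  √(Real.Gamma (a + 1) / (n.factorial * Real.Gamma (n + a + 1))) * (-1) ^ n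

theorem isClassicalSystem_laguerre (ha : -1 < a) :
    IsClassicalSystem (laguerreMeasure1 a) X (C (a + 1) - X)
      (fun n => C (laguerreConst a n) * rodrigues X (C (a + 1) - X) n n)
      fun n => -((n : ℝ) * (n - 1) * (X : ℝ[X]).coeff 2 + n * (C (a + 1) - X : ℝ[X]).coeff 1) := by
  have hX : (X : ℝ[X]).coeff 2 = 0 := by rw [coeff_X, if_neg (by norm_num)]
  have hτ : (C (a + 1) - X : ℝ[X]).coeff 1 = -1 := by
    rw [coeff_sub, coeff_C_of_ne_zero one_ne_zero, coeff_X_one]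
    norm_num
  refine isClassicalSystem_rodrigues (by rw [natDegree_X]; norm_num)
    (natDegree_sub_le_of_le ((natDegree_C _).le.trans zero_le_one) natDegree_X_le) (exp_moment_laguerreMeasure1 ha)
    (integral_pearson_laguerreMeasure1 ha) (fun n => ?_) fun n => ?_
  · rw [hX, hτ]
    have : (0 : ℝ) ≤ n := n.cast_nonneg
    linarith
  · have hn : (0 : ℝ) ≤ n := n.cast_nonneg
    have h1 := Real.Gamma_pos_of_pos (s := a + 1) (by linarith)
    have h2 := Real.Gamma_pos_of_pos (s := n + a + 1) (by linarith)
    have h3 : (0 : ℝ) < n.factorial := by exact_mod_cast n.factorial_pos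
    simp only [hX, hτ, mul_zero, zero_add, Finset.prod_const, Finset.card_range, eval_X]
    rw [integral_pow_laguerreMeasure1 ha, laguerreConst, mul_pow,
      Real.sq_sqrt (by positivity)]
    have h4 : ((-1 : ℝ) ^ n) * (-1) ^ n = 1 := by rw [← mul_pow]; norm_num
    field_simp
    linear_combination ((-1 : ℝ) ^ n * (-1) ^ n + 1) * h4

/-- The Rodrigues expression with real powers is a polynomial only on `x > 0`, which is almost
everywhere for the measure. The constant `Γ(a + 1)` in the density plays no role in the Pearson
equation. -/
theorem laguerre1_eq_eval (n : ℕ) {x : ℝ} (hx : 0 < x) :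
    laguerre1 a n x = (C (laguerreConst a n) * rodrigues X (C (a + 1) - X) n n).eval x := by
  have hw : ∀ y ∈ Set.Ioi (0 : ℝ), HasDerivAt (fun y => y ^ a * Real.exp (-y))
      (y ^ a * Real.exp (-y) * (a / y - 1)) y := by
    intro y hy
    have hy' : (0 : ℝ) < y := hy
    have h1 := (Real.hasDerivAt_rpow_const (p := a) (Or.inl hy'.ne')).mul
      ((hasDerivAt_neg y).exp)
    refine h1.congr_deriv ?_
    rw [Real.rpow_sub_one hy'.ne']
    field_simp
    ring
  have hg : ∀ y ∈ Set.Ioi (0 : ℝ), (X : ℝ[X]).eval y * (a / y - 1) =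
      (C (a + 1) - X : ℝ[X]).eval y - (derivative (X : ℝ[X])).eval y := by
    intro y hy
    have hy' : (0 : ℝ) < y := hy
    simp only [eval_X, eval_sub, eval_C, derivative_X, eval_one]
    field_simp
    ring
  have h2 := iteratedDeriv_pearson isOpen_Ioi hw hg n n le_rfl x hx
  have h3 : (fun y : ℝ => y ^ (n + a) * Real.exp (-y)) =ᶠ[𝓝 x]
      fun y => (X : ℝ[X]).eval y ^ n * (y ^ a * Real.exp (-y)) := by
    filter_upwards [isOpen_Ioi.mem_nhds hx] with y hy
    have hy' : (0 : ℝ) < y := hy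
    rw [Real.rpow_add hy', Real.rpow_natCast, eval_X, mul_assoc]
  rw [laguerre1, h3.iteratedDeriv_eq, h2, eval_mul, eval_C, laguerreConst, Nat.sub_self, pow_zero,
    one_mul, Real.rpow_neg hx.le, Real.exp_neg]
  have := (Real.rpow_pos_of_pos hx a).ne'
  have := (Real.exp_pos x).ne'
  field_simp

theorem ae_laguerreMeasure1 : ∀ᵐ x ∂(laguerreMeasure1 a), 0 < x :=
  (withDensity_absolutelyContinuous _ _).ae_le (ae_restrict_mem measurableSet_Ioi)

theorem ae_pi_of_forall_ae {d : ℕ} {μ : Fin d → Measure ℝ} [∀ i, SigmaFinite (μ i)]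
    {q : ℝ → Prop} (h : ∀ i, ∀ᵐ y ∂(μ i), q y) : ∀ᵐ x ∂(Measure.pi μ), ∀ i, q (x i) :=
  eventually_all.2 fun i => Measure.tendsto_eval_ae_ae.eventually (h i)

theorem inVar_C {d : ℕ} (i : Fin d) (r : ℝ) :
    inVar i (C r) = MvPolynomial.C ((r : ℝ) : ℂ) := by
  rw [inVar, aeval_C, IsScalarTower.algebraMap_apply ℝ ℂ (MvPolynomial (Fin d) ℂ)]
  rfl

theorem laguerreDiff_eq_productDiff {d : ℕ} (α : Fin d → ℝ) :
    laguerreDiff α = productDiff (fun _ => X) fun i => C (α i + 1) - X := by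
  funext p
  change _ = ∑ i, (inVar i X * MvPolynomial.pderiv i (MvPolynomial.pderiv i p) +
    inVar i (C (α i + 1) - X) * MvPolynomial.pderiv i p)
  refine Finset.sum_congr rfl fun i _ => ?_
  have h1 : inVar i (C (α i + 1) - X) =
      MvPolynomial.C ((α i + 1 : ℝ) : ℂ) - MvPolynomial.X i := by
    rw [← inVar_C i]
    simp only [inVar, map_sub, aeval_X]
  rw [h1, inVar, aeval_X]

theorem laguerre_controllability {d : ℕ} (hd : 0 < d) {t₁ : ℝ} (ht₁ : 0 < t₁) {α : Fin d → ℝ}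
    (hα : ∀ i, -1 < α i) (b : Lp ℂ 2 (laguerreMeasure α))
    (hb : ∀ ν, fourierCoef (laguerreMeasure α) (laguerre α) b ν ≠ 0) :
    ApproximatelyControllable (laguerreOperator α)
        (controlOperator (laguerreMeasure α) (laguerre α) b) t₁ ∧
      ¬ ExactlyControllable (laguerreOperator α)
        (controlOperator (laguerreMeasure α) (laguerre α) b) t₁ := by
  have : ∀ i, IsFiniteMeasure (laguerreMeasure1 (α i)) := fun i =>
    isFiniteMeasure_of_exp_moment (exp_moment_laguerreMeasure1 (hα i))
  rw [laguerreOperator, laguerreDiff_eq_productDiff]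
  refine controllability_of_isClassicalSystem (μ := fun i => laguerreMeasure1 (α i)) hd
    (fun i => isClassicalSystem_laguerre (hα i)) (fun ν => ?_) hb ht₁
  filter_upwards [ae_pi_of_forall_ae fun i => ae_laguerreMeasure1 (a := α i)] with x hx
  exact Finset.prod_congr rfl fun i _ => laguerre1_eq_eval _ (hx i)

end LaguerreSystem

/-! ### The Jacobi system -/

section JacobiSystem

open Polynomial

variable {a b : ℝ}

theorem beta_integrand_eq {x : ℝ} (hx : x ∈ Set.Ioc (0 : ℝ) 1) :
    (x : ℂ) ^ (((b + 1 : ℝ) : ℂ) - 1) * (1 - (x : ℂ)) ^ (((a + 1 : ℝ) : ℂ) - 1) =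
      ((x ^ b * (1 - x) ^ a : ℝ) : ℂ) := by
  have h1 : (0 : ℝ) ≤ 1 - x := sub_nonneg.2 hx.2
  rw [Complex.ofReal_mul, Complex.ofReal_cpow hx.1.le, Complex.ofReal_cpow h1]
  push_cast
  rw [add_sub_cancel_right, add_sub_cancel_right]

theorem intervalIntegrable_rpow_mul_one_sub_rpow (ha : -1 < a) (hb : -1 < b) :
    IntervalIntegrable (fun x : ℝ => x ^ b * (1 - x) ^ a) volume 0 1 := by
  have h := Complex.betaIntegral_convergent (u := ((b + 1 : ℝ) : ℂ)) (v := ((a + 1 : ℝ) : ℂ))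
    (by rw [Complex.ofReal_re]; linarith) (by rw [Complex.ofReal_re]; linarith)
  rw [intervalIntegrable_iff_integrableOn_Ioc_of_le zero_le_one] at h ⊢
  refine (integrableOn_congr_fun (fun x hx => ?_) measurableSet_Ioc).1 h.re
  rw [beta_integrand_eq hx]
  simp only [RCLike.re_to_complex, Complex.ofReal_re]

theorem integral_rpow_mul_one_sub_rpow (ha : -1 < a) (hb : -1 < b) :
    ∫ x in (0 : ℝ)..1, x ^ b * (1 - x) ^ a =
      Real.Gamma (a + 1) * Real.Gamma (b + 1) / Real.Gamma (a + b + 2) := by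
  have h := ProbabilityTheory.beta_eq_betaIntegralReal (b + 1) (a + 1) (by linarith) (by linarith)
  rw [ProbabilityTheory.beta, Complex.betaIntegral, intervalIntegral.integral_of_le zero_le_one,
    setIntegral_congr_fun measurableSet_Ioc fun x hx => beta_integrand_eq hx,
    integral_complex_ofReal, Complex.ofReal_re, ← intervalIntegral.integral_of_le zero_le_one,
    show b + 1 + (a + 1) = a + b + 2 by ring] at h
  rw [← h, mul_comm (Real.Gamma (b + 1))]

/-- The substitution `y = (1 + x) / 2`, which reduces the weight to the Beta integrand on `[0, 1]`.
-/
theorem jacobi_weight_eq {x : ℝ} (hx : x ∈ Set.Ioo (-1 : ℝ) 1) :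
    (1 - x) ^ a * (1 + x) ^ b =
      2 ^ (a + b) * ((1 / 2 * x + 1 / 2) ^ b * (1 - (1 / 2 * x + 1 / 2)) ^ a) := by
  have h1 : (0 : ℝ) ≤ 1 - x := by linarith [hx.2]
  have h2 : (0 : ℝ) ≤ 1 + x := by linarith [hx.1]
  rw [show 1 / 2 * x + 1 / 2 = (1 + x) / 2 by ring, show 1 - (1 + x) / 2 = (1 - x) / 2 by ring,
    Real.div_rpow h1 two_pos.le, Real.div_rpow h2 two_pos.le, Real.rpow_add two_pos]
  have := (Real.rpow_pos_of_pos two_pos a).ne'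
  have := (Real.rpow_pos_of_pos two_pos b).ne'
  field_simp

theorem integrableOn_jacobi_weight (ha : -1 < a) (hb : -1 < b) :
    IntegrableOn (fun x : ℝ => (1 - x) ^ a * (1 + x) ^ b) (Set.Ioo (-1) 1) := by
  have h1 := ((intervalIntegrable_rpow_mul_one_sub_rpow ha hb).comp_add_right (1 / 2)).comp_mul_left
    (c := 1 / 2)
  norm_num at h1
  rw [intervalIntegrable_iff_integrableOn_Ioo_of_le (by norm_num)] at h1
  refine (integrableOn_congr_fun (fun x hx => ?_) measurableSet_Ioo).1
    (Integrable.const_mul h1 (2 ^ (a + b)))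
  simp only [jacobi_weight_eq hx]

theorem integral_jacobi_weight (ha : -1 < a) (hb : -1 < b) :
    ∫ x in Set.Ioo (-1 : ℝ) 1, (1 - x) ^ a * (1 + x) ^ b =
      2 ^ (a + b + 1) * (Real.Gamma (a + 1) * Real.Gamma (b + 1)) / Real.Gamma (a + b + 2) := by
  rw [setIntegral_congr_fun measurableSet_Ioo fun x hx => jacobi_weight_eq hx, integral_const_mul,
    ← integral_Ioc_eq_integral_Ioo, ← intervalIntegral.integral_of_le (by norm_num),
    intervalIntegral.integral_comp_mul_add (fun x : ℝ => x ^ b * (1 - x) ^ a) (by norm_num) (1 / 2),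
    show (1 / 2 : ℝ) * -1 + 1 / 2 = 0 by norm_num, show (1 / 2 : ℝ) * 1 + 1 / 2 = 1 by norm_num,
    integral_rpow_mul_one_sub_rpow ha hb, Real.rpow_add two_pos _ 1, Real.rpow_one, smul_eq_mul]
  ring

/-- The Jacobi measure `(1 - x)^a (1 + x)^b dx` on `[-1, 1]`. -/
def jacobiMeasure1 (a b : ℝ) : Measure ℝ :=
  (volume.restrict (Set.Icc (-1 : ℝ) 1)).withDensity fun x =>
    ENNReal.ofReal ((1 - x) ^ a * (1 + x) ^ b)

theorem jacobiMeasure1_eq : jacobiMeasure1 a b =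
    (volume.restrict (Set.Ioo (-1 : ℝ) 1)).withDensity fun x =>
      ENNReal.ofReal ((1 - x) ^ a * (1 + x) ^ b) := by
  rw [jacobiMeasure1, restrict_Ioo_eq_restrict_Icc]

theorem jacobi_weight_nonneg : ∀ x ∈ Set.Ioo (-1 : ℝ) 1, 0 ≤ (1 - x) ^ a * (1 + x) ^ b :=
  fun x hx => mul_nonneg (Real.rpow_nonneg (by linarith [hx.2]) _)
    (Real.rpow_nonneg (by linarith [hx.1]) _)

theorem exp_moment_jacobiMeasure1 (ha : -1 < a) (hb : -1 < b) : ∃ c : ℝ, 0 < c ∧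
    ∀ n : ℕ, Integrable (fun x => |x| ^ n * Real.exp (c * |x|)) (jacobiMeasure1 a b) := by
  refine ⟨1, one_pos, fun n => ?_⟩
  rw [jacobiMeasure1_eq, integrable_restrict_withDensity_iff measurableSet_Ioo (by fun_prop)
    jacobi_weight_nonneg]
  refine ((integrableOn_jacobi_weight ha hb).mul_const (Real.exp 1)).mono'
    (Measurable.aestronglyMeasurable (by fun_prop)) ?_
  filter_upwards [ae_restrict_mem measurableSet_Ioo] with x hx
  have h0 := jacobi_weight_nonneg (a := a) (b := b) x hx
  have hx1 : |x| ≤ 1 := abs_le.2 ⟨hx.1.le, hx.2.le⟩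
  rw [Real.norm_of_nonneg (by positivity), one_mul]
  refine mul_le_mul_of_nonneg_left ?_ h0
  calc |x| ^ n * Real.exp |x| ≤ 1 * Real.exp 1 := by
        gcongr
        exact pow_le_one₀ (abs_nonneg _) hx1
    _ = Real.exp 1 := one_mul _

theorem integral_pow_mul_pow_jacobiMeasure1 (ha : -1 < a) (hb : -1 < b) (m n : ℕ) :
    ∫ x, (1 - x) ^ m * (1 + x) ^ n ∂(jacobiMeasure1 a b) =
      2 ^ (a + m + (b + n) + 1) * (Real.Gamma (a + m + 1) * Real.Gamma (b + n + 1)) /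
        Real.Gamma (a + m + (b + n) + 2) := by
  have hm : (0 : ℝ) ≤ m := m.cast_nonneg
  have hn : (0 : ℝ) ≤ n := n.cast_nonneg
  rw [jacobiMeasure1_eq, integral_restrict_withDensity measurableSet_Ioo (by fun_prop)
    jacobi_weight_nonneg, ← integral_jacobi_weight (by linarith) (by linarith)]
  refine setIntegral_congr_fun measurableSet_Ioo fun x hx => ?_
  have h1 : (0 : ℝ) < 1 - x := by linarith [hx.2]
  have h2 : (0 : ℝ) < 1 + x := by linarith [hx.1]
  rw [Real.rpow_add h1, Real.rpow_add h2, Real.rpow_natCast, Real.rpow_natCast]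
  ring

theorem integral_pearson_jacobiMeasure1 (ha : -1 < a) (hb : -1 < b) (p : ℝ[X]) :
    ∫ x, ((1 - X ^ 2) * derivative p + (C (b - a) - C (a + b + 2) * X) * p).eval x
      ∂(jacobiMeasure1 a b) = 0 := by
  have hi := integrable_eval_of_exp_moment (exp_moment_jacobiMeasure1 ha hb)
  -- Powers of `1 + X` are used because their moments are single Beta integrals, so the identity
  -- becomes a Gamma recursion between two consecutive moments.
  obtain ⟨q, rfl⟩ : ∃ q : ℝ[X], p = q.comp (1 + X) :=
    ⟨p.comp (X - 1), by rw [comp_assoc]; simp⟩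
  induction q using Polynomial.induction_on' with
  | add p q hp hq =>
    have h := integral_add
      (hi ((1 - X ^ 2) * derivative (p.comp (1 + X)) +
        (C (b - a) - C (a + b + 2) * X) * p.comp (1 + X)))
      (hi ((1 - X ^ 2) * derivative (q.comp (1 + X)) +
        (C (b - a) - C (a + b + 2) * X) * q.comp (1 + X)))
    rw [hp, hq, add_zero] at h
    rw [← h]
    congr 1
    ext x
    rw [← eval_add, add_comp, derivative_add]
    congr 1
    ring
  | monomial n r =>
    have h1 : ∀ x : ℝ, ((1 - X ^ 2) * derivative ((monomial n r).comp (1 + X)) +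
        (C (b - a) - C (a + b + 2) * X) * (monomial n r).comp (1 + X)).eval x =
        r * (2 * n + 2 * b + 2) * (1 + x) ^ n - r * (n + a + b + 2) * (1 + x) ^ (n + 1) := by
      intro x
      rcases n with _ | n
      · simp
        ring
      · simp [monomial_comp, derivative_pow]
        ring
    have hpow : ∀ k : ℕ, Integrable (fun x : ℝ => (1 + x) ^ k) (jacobiMeasure1 a b) := fun k => by
      have h := hi ((1 + X) ^ k)
      simp only [eval_pow, eval_add, eval_one, eval_X] at h
      exact h
    have hn : (0 : ℝ) ≤ n := n.cast_nonneg
    have hval : ∀ k : ℕ, ∫ x, (1 + x) ^ k ∂(jacobiMeasure1 a b) =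
        2 ^ (a + (b + k) + 1) * (Real.Gamma (a + 1) * Real.Gamma (b + k + 1)) /
          Real.Gamma (a + (b + k) + 2) := fun k => by
      have h := integral_pow_mul_pow_jacobiMeasure1 ha hb 0 k
      simp only [pow_zero, one_mul, Nat.cast_zero, add_zero] at h
      exact h
    simp only [h1]
    rw [integral_sub ((hpow n).const_mul _) ((hpow (n + 1)).const_mul _), integral_const_mul,
      integral_const_mul, hval, hval]
    have h2 := Real.Gamma_add_one (s := b + n + 1) (by linarith)
    have h3 := Real.Gamma_add_one (s := a + (b + n) + 2) (by linarith)
    have h4 := Real.rpow_add_one (two_ne_zero (α := ℝ)) (a + (b + n) + 1)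
    have h5 := (Real.Gamma_pos_of_pos (s := a + (b + n) + 2) (by linarith)).ne'
    have h6 : a + (b + n) + 2 ≠ 0 := by linarith
    push_cast
    rw [show b + ((n : ℝ) + 1) + 1 = b + n + 1 + 1 by ring, h2,
      show a + (b + ((n : ℝ) + 1)) + 2 = a + (b + n) + 2 + 1 by ring, h3,
      show a + (b + ((n : ℝ) + 1)) + 1 = a + (b + n) + 1 + 1 by ring, h4]
    field_simp
    ring

theorem prod_range_add_mul_Gamma {s : ℝ} (hs : 0 < s) (n : ℕ) :
    (∏ j ∈ Finset.range n, (s + n - 1 - j)) * Real.Gamma s = Real.Gamma (s + n) := by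
  induction n with
  | zero => simp
  | succ n ih =>
    have hn : (0 : ℝ) ≤ n := n.cast_nonneg
    have h := Real.Gamma_add_one (s := s + n) (by linarith)
    rw [Finset.prod_range_succ', Finset.prod_congr rfl fun j _ =>
      show s + ((n + 1 : ℕ) : ℝ) - 1 - ((j + 1 : ℕ) : ℝ) = s + n - 1 - j by push_cast; ring]
    push_cast
    rw [show s + ((n : ℝ) + 1) = s + n + 1 by ring, h, ← ih]
    ring

theorem jacobiNormSq_pos (ha : -1 < a) (hb : -1 < b) (n : ℕ) : 0 < jacobiNormSq a b n := by
  have h2 : ∀ r : ℝ, 0 < (2 : ℝ) ^ r := fun r => Real.rpow_pos_of_pos two_pos r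
  rw [jacobiNormSq]
  split_ifs with h
  · have h3 := Real.Gamma_pos_of_pos (s := a + 1) (by linarith)
    have h4 := Real.Gamma_pos_of_pos (s := b + 1) (by linarith)
    have h5 := Real.Gamma_pos_of_pos (s := a + b + 2) (by linarith)
    have := h2 (a + b + 1)
    positivity
  · have hn : (1 : ℝ) ≤ n := by exact_mod_cast Nat.one_le_iff_ne_zero.2 h
    have h3 := Real.Gamma_pos_of_pos (s := n + a + 1) (by linarith)
    have h4 := Real.Gamma_pos_of_pos (s := n + b + 1) (by linarith)
    have h5 := Real.Gamma_pos_of_pos (s := n + a + b + 1) (by linarith)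
    have h6 := Real.Gamma_pos_of_pos (s := (n : ℝ) + 1) (by linarith)
    have h7 : 0 < 2 * (n : ℝ) + a + b + 1 := by linarith
    have := h2 (a + b + 1)
    positivity

/-- Brings the standard constant into the form delivered by `map_rodrigues_mul_self`: the leading
coefficient product, with `4 ^ n * n.factorial` from the Rodrigues prefactor, times the integral of
`(1 - x ^ 2) ^ n`. -/
theorem jacobiNormSq_eq (ha : -1 < a) (hb : -1 < b) (n : ℕ) :
    jacobiNormSq a b n = (∏ j ∈ Finset.range n, (2 * (n : ℝ) - j + a + b)) / (4 ^ n * n.factorial) *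
      (2 ^ (a + n + (b + n) + 1) * (Real.Gamma (a + n + 1) * Real.Gamma (b + n + 1)) /
        Real.Gamma (a + n + (b + n) + 2)) := by
  rw [jacobiNormSq]
  split_ifs with h
  · simp [h]
  · have hn : (1 : ℝ) ≤ n := by exact_mod_cast Nat.one_le_iff_ne_zero.2 h
    -- Uses `n ≥ 1` and `a + b > -2`; at `n = 0` this can fail, hence the separate branch.
    have hs : 0 < (n : ℝ) + a + b + 1 := by linarith
    have h1 := prod_range_add_mul_Gamma hs n
    have hprod : ∏ j ∈ Finset.range n, ((n : ℝ) + a + b + 1 + n - 1 - j) =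
        ∏ j ∈ Finset.range n, (2 * (n : ℝ) - j + a + b) :=
      Finset.prod_congr rfl fun j _ => by ring
    rw [hprod] at h1
    have h2 := Real.Gamma_add_one (s := n + a + b + 1 + n) (by linarith)
    have h3 := (Real.Gamma_pos_of_pos hs).ne'
    have h4 := (Real.Gamma_pos_of_pos (s := n + a + b + 1 + n) (by linarith)).ne'
    have h5 : 2 * (n : ℝ) + a + b + 1 ≠ 0 := by linarith
    have h6 : (2 : ℝ) ^ (a + n + (b + n) + 1) = 2 ^ (a + b + 1) * 4 ^ n := by
      rw [show a + n + (b + n) + 1 = a + b + 1 + ((2 * n : ℕ) : ℝ) by push_cast; ring,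
        Real.rpow_add two_pos, Real.rpow_natCast, pow_mul]
      norm_num
    have h7 : (n.factorial : ℝ) ≠ 0 := by exact_mod_cast n.factorial_ne_zero
    rw [h6, show a + n + (b + n) + 2 = n + a + b + 1 + n + 1 by ring, h2, ← h1,
      Real.Gamma_nat_eq_factorial, show a + (n : ℝ) + 1 = n + a + 1 by ring,
      show b + (n : ℝ) + 1 = n + b + 1 by ring]
    have h8 : ∏ j ∈ Finset.range n, (2 * (n : ℝ) - j + a + b) ≠ 0 := fun h0 => by
      rw [h0, zero_mul] at h1
      exact h4 h1.symm
    rw [show (n : ℝ) + a + b + 1 + n = 2 * n + a + b + 1 by ring]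
    field_simp

/-- The normalization of the one-dimensional Jacobi polynomials. -/
def jacobiConst (a b : ℝ) (n : ℕ) : ℝ :=
  (√(jacobiNormSq a b n))⁻¹ * ((-1) ^ n / (2 ^ n * n.factorial))

theorem isClassicalSystem_jacobi (ha : -1 < a) (hb : -1 < b) :
    IsClassicalSystem (jacobiMeasure1 a b) (1 - X ^ 2) (C (b - a) - C (a + b + 2) * X)
      (fun n => C (jacobiConst a b n) *
        rodrigues (1 - X ^ 2) (C (b - a) - C (a + b + 2) * X) n n)
      fun n => -((n : ℝ) * (n - 1) * (1 - X ^ 2 : ℝ[X]).coeff 2 +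
        n * (C (b - a) - C (a + b + 2) * X : ℝ[X]).coeff 1) := by
  have hX : (1 - X ^ 2 : ℝ[X]).coeff 2 = -1 := by
    rw [coeff_sub, coeff_X_pow, coeff_one]
    norm_num
  have hτ : (C (b - a) - C (a + b + 2) * X : ℝ[X]).coeff 1 = -(a + b + 2) := by
    rw [coeff_sub, coeff_C_of_ne_zero one_ne_zero, coeff_C_mul, coeff_X_one]
    ring
  refine isClassicalSystem_rodrigues
    (natDegree_sub_le_of_le (natDegree_one.le.trans zero_le_two) (natDegree_X_pow_le 2))
    (natDegree_sub_le_of_le ((natDegree_C _).le.trans zero_le_one) ((natDegree_C_mul_le _ _).trans natDegree_X_le))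
    (exp_moment_jacobiMeasure1 ha hb)
    (integral_pearson_jacobiMeasure1 ha hb) (fun n => ?_) fun n => ?_
  · rw [hX, hτ]
    -- The eigenvalue is `-n (n + a + b + 1)`. The second factor may be negative at `n = 0`, where
    -- the product vanishes anyway.
    rcases n with _ | n
    · simp
    · have hn : (0 : ℝ) ≤ n := n.cast_nonneg
      push_cast
      nlinarith
  · rw [hX, hτ]
    have h1 : ∀ x : ℝ, (1 - X ^ 2 : ℝ[X]).eval x ^ n = (1 - x) ^ n * (1 + x) ^ n := by
      intro x
      rw [← mul_pow]
      simp
      ring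
    have hpos := jacobiNormSq_pos ha hb n
    have h3 : (n.factorial : ℝ) ≠ 0 := by exact_mod_cast n.factorial_ne_zero
    have h4 : ((-1 : ℝ) ^ n) * (-1) ^ n = 1 := by rw [← mul_pow]; norm_num
    have h5 : ∏ j ∈ Finset.range n, ((2 * (n : ℝ) - j - 2) * -1 + -(a + b + 2)) =
        (-1) ^ n * ∏ j ∈ Finset.range n, (2 * (n : ℝ) - j + a + b) := by
      rw [← Finset.card_range n, ← Finset.prod_const, Finset.card_range, ← Finset.prod_mul_distrib]
      exact Finset.prod_congr rfl fun j _ => by ring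
    have h6 := jacobiNormSq_eq ha hb n
    rw [← integral_pow_mul_pow_jacobiMeasure1 ha hb] at h6
    simp only [h1]
    rw [h5, jacobiConst, mul_pow, inv_pow, Real.sq_sqrt hpos.le]
    have h7 : (∏ j ∈ Finset.range n, (2 * (n : ℝ) - j + a + b)) *
        ∫ x, (1 - x) ^ n * (1 + x) ^ n ∂(jacobiMeasure1 a b) =
        jacobiNormSq a b n * (4 ^ n * n.factorial) := by
      rw [h6]
      field_simp
    have h8 : (4 : ℝ) ^ n = 2 ^ n * 2 ^ n := by rw [← mul_pow]; norm_num
    calc _ = (jacobiNormSq a b n)⁻¹ * (((-1) ^ n * (-1) ^ n) * ((-1) ^ n * (-1) ^ n)) /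
          (2 ^ n * 2 ^ n * n.factorial) * ((∏ j ∈ Finset.range n, (2 * (n : ℝ) - j + a + b)) *
            ∫ x, (1 - x) ^ n * (1 + x) ^ n ∂(jacobiMeasure1 a b)) := by
          field_simp
      _ = 1 := by
          rw [h7, h4, h8]
          field_simp

/-- Holds on the open interval, where the real powers have positive bases and `(1 - y) ^ n * (1 + y)
^ n` splits off as `σ ^ n`; the endpoints are null. -/
theorem jacobi1_eq_eval (n : ℕ) {x : ℝ} (hx : x ∈ Set.Ioo (-1 : ℝ) 1) :
    jacobi1 a b n x = (C (jacobiConst a b n) *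
      rodrigues (1 - X ^ 2) (C (b - a) - C (a + b + 2) * X) n n).eval x := by
  have hpos : ∀ y ∈ Set.Ioo (-1 : ℝ) 1, 0 < 1 - y ∧ 0 < 1 + y := fun y hy =>
    ⟨by linarith [hy.2], by linarith [hy.1]⟩
  have hw : ∀ y ∈ Set.Ioo (-1 : ℝ) 1, HasDerivAt (fun y => (1 - y) ^ a * (1 + y) ^ b)
      ((1 - y) ^ a * (1 + y) ^ b * (-a / (1 - y) + b / (1 + y))) y := by
    intro y hy
    obtain ⟨h1, h2⟩ := hpos y hy
    have h3 := (((hasDerivAt_id y).const_sub 1).rpow_const (p := a) (Or.inl h1.ne')).mul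
      (((hasDerivAt_id y).const_add 1).rpow_const (p := b) (Or.inl h2.ne'))
    refine h3.congr_deriv ?_
    simp only [id]
    rw [Real.rpow_sub_one h1.ne', Real.rpow_sub_one h2.ne']
    field_simp
  have hg : ∀ y ∈ Set.Ioo (-1 : ℝ) 1, (1 - X ^ 2 : ℝ[X]).eval y * (-a / (1 - y) + b / (1 + y)) =
      (C (b - a) - C (a + b + 2) * X : ℝ[X]).eval y -
        (derivative (1 - X ^ 2 : ℝ[X])).eval y := by
    intro y hy
    obtain ⟨h1, h2⟩ := hpos y hy
    have h3 : (1 - y ^ 2) * (-a / (1 - y) + b / (1 + y)) = -a * (1 + y) + b * (1 - y) := by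
      field_simp
      ring
    simp only [eval_sub, eval_one, eval_pow, eval_X, eval_C, eval_mul, derivative_sub,
      derivative_one, derivative_X_pow]
    rw [h3]
    simp
    ring
  have h2 := iteratedDeriv_pearson isOpen_Ioo hw hg n n le_rfl x hx
  have h3 : (fun y : ℝ => (1 - y) ^ (a + n) * (1 + y) ^ (b + n)) =ᶠ[𝓝 x]
      fun y => (1 - X ^ 2 : ℝ[X]).eval y ^ n * ((1 - y) ^ a * (1 + y) ^ b) := by
    filter_upwards [isOpen_Ioo.mem_nhds hx] with y hy
    obtain ⟨h1, h2⟩ := hpos y hy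
    rw [Real.rpow_add h1, Real.rpow_add h2, Real.rpow_natCast, Real.rpow_natCast]
    simp only [eval_sub, eval_one, eval_pow, eval_X]
    rw [show 1 - y ^ 2 = (1 - y) * (1 + y) by ring, mul_pow]
    ring
  obtain ⟨h4, h5⟩ := hpos x hx
  rw [jacobi1, h3.iteratedDeriv_eq, h2, eval_mul, eval_C, jacobiConst, Nat.sub_self, pow_zero,
    one_mul, Real.rpow_neg h4.le, Real.rpow_neg h5.le]
  have := (Real.rpow_pos_of_pos h4 a).ne'
  have := (Real.rpow_pos_of_pos h5 b).ne'
  field_simp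

theorem ae_jacobiMeasure1 : ∀ᵐ x ∂(jacobiMeasure1 a b), x ∈ Set.Ioo (-1 : ℝ) 1 := by
  rw [jacobiMeasure1_eq]
  exact (withDensity_absolutelyContinuous _ _).ae_le (ae_restrict_mem measurableSet_Ioo)

theorem jacobiDiff_eq_productDiff {d : ℕ} (α β : Fin d → ℝ) :
    jacobiDiff α β = productDiff (fun _ => 1 - X ^ 2)
      fun i => C (β i - α i) - C (α i + β i + 2) * X := by
  funext p
  change _ = ∑ i, (inVar i (1 - X ^ 2) * MvPolynomial.pderiv i (MvPolynomial.pderiv i p) +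
    inVar i (C (β i - α i) - C (α i + β i + 2) * X) * MvPolynomial.pderiv i p)
  refine Finset.sum_congr rfl fun i _ => ?_
  have h1 : inVar i (C (β i - α i) - C (α i + β i + 2) * X) =
      MvPolynomial.C ((β i - α i : ℝ) : ℂ) -
        MvPolynomial.C ((α i + β i + 2 : ℝ) : ℂ) * MvPolynomial.X i := by
    rw [← inVar_C i, ← inVar_C i]
    simp only [inVar, map_sub, map_mul, aeval_X]
  have h2 : inVar i (1 - X ^ 2) = 1 - MvPolynomial.X i ^ 2 := by
    simp only [inVar, map_sub, map_one, map_pow, aeval_X]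
  rw [h1, h2]

theorem jacobi_controllability {d : ℕ} (hd : 0 < d) {t₁ : ℝ} (ht₁ : 0 < t₁) {α β : Fin d → ℝ}
    (hα : ∀ i, -1 < α i) (hβ : ∀ i, -1 < β i) (b : Lp ℂ 2 (jacobiMeasure α β))
    (hb : ∀ ν, fourierCoef (jacobiMeasure α β) (jacobi α β) b ν ≠ 0) :
    ApproximatelyControllable (jacobiOperator α β)
        (controlOperator (jacobiMeasure α β) (jacobi α β) b) t₁ ∧
      ¬ ExactlyControllable (jacobiOperator α β)
        (controlOperator (jacobiMeasure α β) (jacobi α β) b) t₁ := by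
  have : ∀ i, IsFiniteMeasure (jacobiMeasure1 (α i) (β i)) := fun i =>
    isFiniteMeasure_of_exp_moment (exp_moment_jacobiMeasure1 (hα i) (hβ i))
  rw [jacobiOperator, jacobiDiff_eq_productDiff]
  refine controllability_of_isClassicalSystem (μ := fun i => jacobiMeasure1 (α i) (β i)) hd
    (fun i => isClassicalSystem_jacobi (hα i) (hβ i)) (fun ν => ?_) hb ht₁
  filter_upwards [ae_pi_of_forall_ae fun i => ae_jacobiMeasure1 (a := α i) (b := β i)] with x hx
  exact Finset.prod_congr rfl fun i _ => jacobi1_eq_eval _ (hx i)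

end JacobiSystem

end OrthControl

end

theorem mainTheorem1 (d : ℕ) (hd : 0 < d) (t₁ : ℝ) (ht₁ : 0 < t₁) :
    (∀ α : Fin d → ℝ, (∀ i, -1 < α i) →
      ∀ b : Lp ℂ 2 (OrthControl.laguerreMeasure α),
        (∀ ν : Fin d → ℕ, OrthControl.fourierCoef (OrthControl.laguerreMeasure α)
          (OrthControl.laguerre α) b ν ≠ 0) →
        OrthControl.ApproximatelyControllable (OrthControl.laguerreOperator α)
            (OrthControl.controlOperator (OrthControl.laguerreMeasure α)
              (OrthControl.laguerre α) b) t₁ ∧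
          ¬ OrthControl.ExactlyControllable (OrthControl.laguerreOperator α)
            (OrthControl.controlOperator (OrthControl.laguerreMeasure α)
              (OrthControl.laguerre α) b) t₁) ∧
    (∀ α β : Fin d → ℝ, (∀ i, -1 < α i) → (∀ i, -1 < β i) →
      ∀ b : Lp ℂ 2 (OrthControl.jacobiMeasure α β),
        (∀ ν : Fin d → ℕ, OrthControl.fourierCoef (OrthControl.jacobiMeasure α β)
          (OrthControl.jacobi α β) b ν ≠ 0) →
        OrthControl.ApproximatelyControllable (OrthControl.jacobiOperator α β)
            (OrthControl.controlOperator (OrthControl.jacobiMeasure α β)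
              (OrthControl.jacobi α β) b) t₁ ∧
          ¬ OrthControl.ExactlyControllable (OrthControl.jacobiOperator α β)
            (OrthControl.controlOperator (OrthControl.jacobiMeasure α β)
              (OrthControl.jacobi α β) b) t₁) := by
  exact ⟨fun _ hα b hb => OrthControl.laguerre_controllability hd ht₁ hα b hb,
    fun _ _ hα hβ b hb => OrthControl.jacobi_controllability hd ht₁ hα hβ b hb⟩
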